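/- Let $n\ge 1$ and let $K\subset\mathbb{R}^n$ be a convex body (compact, convex) with $0\in\operatorname{Int}K$, whose boundary is of class $C^2$ and has everywhere positive Gauss curvature (for $n=1$ the Gauss curvature is $1$ by convention). For such a body $L$ let $\nu$ be its outer unit normal and $\mathcal{K}$ its Gauss curvature, as functions on $\partial L$, let $$\mathcal{K}_0(x)=\frac{\mathcal{K}(x)}{(x\cdot \nu(x))^{n+1}},\qquad x\in\partial L,$$ be its centro-affine curvature, and let $\mu_{cL}$ be the cone measure on $\partial L$ of total mass $n\,\mathrm{Vol}(L)$, that is $\mu_{cL}(A)=n\,\mathrm{Vol}(\{tx: x\in A,\ 0<t\le 1\})$ (equivalently, $d\mu_{cL}=(x\cdot\nu(x))\,d\mu_L$ with $\mu_L$ the surface area measure of $\partial L$). Let $L^\circ=\{y\in\mathbb{R}^n : x\cdot y\le 1\ \ \forall x\in L\}$ be the polar body. The $L_q$ affine surface area of $L$ is $$\Omega_q(L)=\int_{\partial L}\mathcal{K}_0^{\frac{q}{n+q}}\,d\mu_{cL}\quad (q\in\mathbb{R},\ q\ne -n),\qquad \Omega_{\pm\infty}(L)=n\,\mathrm{Vol}(L^\circ).$$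 Let $p\in\mathbb{R}$, $p\neq 0,-n$, let $\varepsilon=\operatorname{sgn}\frac{p}{n+p}$ and $q=-\frac{np}{n+2p}$, where $q=\pm\infty$ if $p=-\frac n2$. Then $$\varepsilon\,\frac{\Omega_p(K)}{\Omega_q(K^\circ)}\ \le\ \varepsilon\,\frac{\mathrm{Vol}(K)}{\mathrm{Vol}(K^\circ)}\ \le\ \varepsilon\,\frac{\Omega_q(K)}{\Omega_p(K^\circ)}.$$ Equality holds in the left inequality if and only if $K$ is an ellipsoid centred at the origin, and equality holds in the right inequality if and only if $K$ is an ellipsoid centred at the origin. -/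

import Mathlib

open MeasureTheory Topology

noncomputable section

namespace CentroAffine

variable {n : ℕ}

/-- The polar of a set with respect to the origin, `K° = {y | ⟨x, y⟩ ≤ 1 for all x ∈ K}`. -/
def polarBody (K : Set (EuclideanSpace ℝ (Fin n))) : Set (EuclideanSpace ℝ (Fin n)) :=
  {y | ∀ x ∈ K, inner ℝ x y ≤ 1}

/-- The volume of a set, as a real number. -/
def vol (K : Set (EuclideanSpace ℝ (Fin n))) : ℝ :=
  (volume K).toReal

/-- The boundary of `K` is of class `C²`: near each of its boundary points, `K` is the sublevel
set `{f ≤ 0}` of a `C²` function `f` with nonvanishing differential. -/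
def HasC2Boundary (K : Set (EuclideanSpace ℝ (Fin n))) : Prop :=
  ∀ x ∈ frontier K, ∃ f : EuclideanSpace ℝ (Fin n) → ℝ,
    ContDiffAt ℝ 2 f x ∧ fderiv ℝ f x ≠ 0 ∧ ∀ᶠ y in 𝓝 x, (y ∈ K ↔ f y ≤ 0)

/-- `u` is an outer unit normal vector of the convex set `K` at the point `x`. -/
def IsOuterUnitNormal (K : Set (EuclideanSpace ℝ (Fin n)))
    (x u : EuclideanSpace ℝ (Fin n)) : Prop :=
  ‖u‖ = 1 ∧ ∀ y ∈ K, inner ℝ y u ≤ inner ℝ x u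

/-- The Gauss map `ν` of `∂K`. For a convex body with `C²` boundary the outer unit normal at a
boundary point exists and is unique, so that no choice is involved. -/
def gaussMap (K : Set (EuclideanSpace ℝ (Fin n))) (x : EuclideanSpace ℝ (Fin n)) :
    EuclideanSpace ℝ (Fin n) :=
  Classical.epsilon (IsOuterUnitNormal K x)

/-- The radial projection `y ↦ y / g(y)` of `ℝⁿ ∖ {0}` onto `∂K`, where `g` is the gauge of a
convex body `K` with the origin in its interior; it is the identity on `∂K`. -/
def radialProjection (K : Set (EuclideanSpace ℝ (Fin n))) (y : EuclideanSpace ℝ (Fin n)) :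
    EuclideanSpace ℝ (Fin n) :=
  (gauge K y)⁻¹ • y

/-- The tangent space `ν(x)^⊥` of `∂K` at the boundary point `x`. -/
def tangentSpace (K : Set (EuclideanSpace ℝ (Fin n))) (x : EuclideanSpace ℝ (Fin n)) :
    Submodule ℝ (EuclideanSpace ℝ (Fin n)) :=
  (Submodule.span ℝ {gaussMap K x})ᗮ

/-- The Weingarten map `dν` of `∂K` at `x`, an endomorphism of the tangent space. The Gauss map is
differentiated along `∂K` by extending it to a neighbourhood of `x` as a constant on the rays from
the origin and restricting the differential to the tangent space. The differential maps
into the tangent space because `ν` has unit length, and the orthogonal projection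
only records this. -/
def weingartenMap (K : Set (EuclideanSpace ℝ (Fin n))) (x : EuclideanSpace ℝ (Fin n)) :
    tangentSpace K x →ₗ[ℝ] tangentSpace K x :=
  (((tangentSpace K x).orthogonalProjectionOnto).comp
    ((fderiv ℝ (fun y => gaussMap K (radialProjection K y)) x).comp
      (tangentSpace K x).subtypeL)).toLinearMap

/-- The Gauss (Gauss–Kronecker) curvature of `∂K` at `x`, the determinant of the Weingarten map. -/
def gaussCurvature (K : Set (EuclideanSpace ℝ (Fin n))) (x : EuclideanSpace ℝ (Fin n)) : ℝ :=
  LinearMap.det (weingartenMap K x)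

/-- The centro-affine curvature `κ(x) / ⟨x, ν(x)⟩ ^ (n + 1)`. -/
def centroAffineCurvature (K : Set (EuclideanSpace ℝ (Fin n)))
    (x : EuclideanSpace ℝ (Fin n)) : ℝ :=
  gaussCurvature K x / (inner ℝ x (gaussMap K x)) ^ (n + 1)

/-- The cone measure of `∂K`, of total mass `n * vol K`: the measure of `A ⊆ ∂K` is `n` times
the volume of the cone `{t x | x ∈ A, 0 < t ≤ 1}`. In terms of the surface area measure of `∂K`
its density is `⟨x, ν(x)⟩`. -/
def coneMeasure (K : Set (EuclideanSpace ℝ (Fin n))) : Measure (EuclideanSpace ℝ (Fin n)) :=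
  (n : ENNReal) • (volume.restrict K).map (radialProjection K)

/-- The `L_p` affine surface area, for `p` real or infinite (there is one infinite index,
for `±∞`): the integral over `∂K` of the power `p / (n + p)` of the centro-affine curvature against
the cone measure for real `p ≠ -n`, and `n * vol K°` for infinite `p`. -/
def lpAffineSurfaceArea (p : OnePoint ℝ) (K : Set (EuclideanSpace ℝ (Fin n))) : ℝ :=
  match p with
  | none => n * vol (polarBody K)
  | some p => ∫ x, centroAffineCurvature K x ^ (p / (n + p)) ∂(coneMeasure K)

/-- The index `-np / (n + 2p)`, which is infinite for `p = -n / 2`. -/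
def dualIndex (n : ℕ) (p : ℝ) : OnePoint ℝ :=
  if (n : ℝ) + 2 * p = 0 then OnePoint.infty else ((-(n * p) / (n + 2 * p) : ℝ) : OnePoint ℝ)

/-- `K` is an ellipsoid centred at the origin: the image of the closed unit ball under an
invertible linear map. -/
def IsCenteredEllipsoid (K : Set (EuclideanSpace ℝ (Fin n))) : Prop :=
  ∃ A : EuclideanSpace ℝ (Fin n) ≃ₗ[ℝ] EuclideanSpace ℝ (Fin n),
    K = A '' Metric.closedBall (0 : EuclideanSpace ℝ (Fin n)) 1

end CentroAffine

end

/-! Let φ be half the squared gauge of K (`gaugeEnergy`) and f = det D²φ. Since φ is homogeneous of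
degree two, f is constant on rays, and on ∂K it equals the centro-affine curvature
(`IsC2Body.centroAffineCurvature_eq`). The cone measure is n times the radial image of Lebesgue
measure on K, so Ω_p(K) = n ∫_K f^s with s = p/(n+p).

The gradient ∇φ maps K∖{0} bijectively onto K°∖{0} with Jacobian f. By Legendre duality its inverse
is the gradient of the corresponding function of K°, so the determinant belonging to K° at ∇φ(x) is
1/f(x). A change of variables turns every integral over K° with exponent s into I(1-s), where I(s) =
∫_K f^s (`integral_det_hessian_polarBody`). The index q is the one whose exponent is -s. Both
inequalities thus become sgn(s) I(s)/I(1+s) ≤ sgn(s) I(0)/I(1), for s and for -s. This is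
Chebyshev's inequality: with c the mean of f over K, the integral of sgn(s)(f^s - c^s)(f - c) is
nonnegative.

Equality forces f to be constant, first almost everywhere and then, by continuity and homogeneity,
off the origin. It remains to see that then D²φ is constant (`exists_hessian_eq_const`), so that φ
is a quadratic form and K an ellipsoid. Each pure second derivative of φ is constant on rays and so
attains its maximum. By the arithmetic-geometric mean inequality, second differences of φ are
subsolutions of the linearized Monge–Ampère equation. Hopf's barrier argument, run on second
differences because φ is only C², gives a strong maximum principle, and the pure second derivatives
are constant. -/

open scoped Gradient RealInnerProductSpace

/-! ### Hessians of convex and of homogeneous functions -/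

section Hessian

variable {E : Type*} [NormedAddCommGroup E] [InnerProductSpace ℝ E] [CompleteSpace E]

/-- The Hessian of a function on a real inner product space, as an endomorphism: the differential
of the gradient. -/
noncomputable def hessian (φ : E → ℝ) (x : E) : E →L[ℝ] E := fderiv ℝ (∇ φ) x

lemma gradient_eq_toDual_symm_comp (φ : E → ℝ) :
    ∇ φ = fun x => (InnerProductSpace.toDual ℝ E).symm (fderiv ℝ φ x) := rfl

lemma contDiffAt_gradient {φ : E → ℝ} {x : E} (h : ContDiffAt ℝ 2 φ x) :
    ContDiffAt ℝ 1 (∇ φ) x := by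
  rw [gradient_eq_toDual_symm_comp]
  have h1 : ContDiffAt ℝ 1 (fderiv ℝ φ) x := h.fderiv_right (by norm_num)
  exact ((InnerProductSpace.toDual ℝ E).symm.toContinuousLinearEquiv.contDiff.contDiffAt).comp x h1

lemma hasFDerivAt_gradient {φ : E → ℝ} {x : E} (h : ContDiffAt ℝ 2 φ x) :
    HasFDerivAt (∇ φ) (hessian φ x) x :=
  ((contDiffAt_gradient h).differentiableAt (by norm_num)).hasFDerivAt

lemma inner_hessian {φ : E → ℝ} {x : E} (h : ContDiffAt ℝ 2 φ x) (v w : E) :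
    ⟪hessian φ x v, w⟫ = fderiv ℝ (fderiv ℝ φ) x v w := by
  have h1 : DifferentiableAt ℝ (fderiv ℝ φ) x :=
    (h.fderiv_right (m := 1) (by norm_num)).differentiableAt (by norm_num)
  have h2 : HasFDerivAt (fun y => fderiv ℝ φ y w) ((fderiv ℝ (fderiv ℝ φ) x).flip w) x := by
    simpa using h1.hasFDerivAt.clm_apply (hasFDerivAt_const w x)
  have h3 : HasFDerivAt (fun y => ⟪∇ φ y, w⟫) ((innerSL ℝ w).comp (hessian φ x)) x := by
    have := (innerSL ℝ w).hasFDerivAt.comp x (hasFDerivAt_gradient h)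
    refine this.congr_of_eventuallyEq (.of_forall fun y => ?_)
    simp
  have h4 : (fun y => ⟪∇ φ y, w⟫) = fun y => fderiv ℝ φ y w := by
    ext y; exact inner_gradient_left
  rw [h4] at h3
  have := congrArg (fun L => L v) (h3.unique h2)
  simpa [real_inner_comm] using this

lemma inner_hessian_comm {φ : E → ℝ} {x : E} (h : ContDiffAt ℝ 2 φ x) (v w : E) :
    ⟪hessian φ x v, w⟫ = ⟪v, hessian φ x w⟫ := by
  rw [real_inner_comm (hessian φ x w), inner_hessian h, inner_hessian h]
  exact h.isSymmSndFDerivAt (by simp) v w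

/-- Along a line through x the derivative of φ is monotone, so its difference quotients at x are
nonnegative, and the Hessian form is their limit. -/
lemma inner_hessian_nonneg {φ : E → ℝ} (hc : ConvexOn ℝ Set.univ φ) {x : E}
    (h : ContDiffAt ℝ 2 φ x) (v : E) : 0 ≤ ⟪hessian φ x v, v⟫ := by
  have hd : ∀ᶠ y in 𝓝 x, DifferentiableAt ℝ φ y :=
    (h.eventually (by simp)).mono fun y hy => hy.differentiableAt (by norm_num)
  have hline : HasDerivAt (fun t : ℝ => x + t • v) v 0 := by
    simpa using ((hasDerivAt_id (0 : ℝ)).smul_const v).const_add x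
  have hl0 : Filter.Tendsto (fun t : ℝ => x + t • v) (𝓝 0) (𝓝 x) := by
    simpa using hline.continuousAt.tendsto
  have h1 : HasDerivAt (fun t : ℝ => ⟪∇ φ (x + t • v), v⟫) ⟪hessian φ x v, v⟫ 0 := by
    have h2 : HasFDerivAt (∇ φ) (hessian φ x) (x + (0 : ℝ) • v) := by
      simpa using hasFDerivAt_gradient h
    have := (h2.comp_hasDerivAt (0 : ℝ) hline).inner ℝ (hasDerivAt_const (0 : ℝ) v)
    simpa using this
  have hconv : ConvexOn ℝ Set.univ (fun t : ℝ => φ (x + t • v)) := by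
    refine ⟨convex_univ, fun s _ t _ a b ha hb hab => ?_⟩
    have := hc.2 (Set.mem_univ (x + s • v)) (Set.mem_univ (x + t • v)) ha hb hab
    convert this using 2
    have hx : x = a • x + b • x := by rw [← add_smul, hab, one_smul]
    nth_rewrite 1 [hx]
    simp only [smul_eq_mul]
    module
  have hder : ∀ᶠ t : ℝ in 𝓝 0,
      HasDerivAt (fun t : ℝ => φ (x + t • v)) ⟪∇ φ (x + t • v), v⟫ t := by
    filter_upwards [hl0.eventually hd] with t ht
    have hline' : HasDerivAt (fun t : ℝ => x + t • v) v t := by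
      simpa using ((hasDerivAt_id t).smul_const v).const_add x
    have := ht.hasFDerivAt.comp_hasDerivAt t hline'
    rwa [inner_gradient_left]
  refine ge_of_tendsto (hasDerivAt_iff_tendsto_slope.1 h1) ?_
  have h0 : HasDerivAt (fun t : ℝ => φ (x + t • v)) ⟪∇ φ (x + (0 : ℝ) • v), v⟫ 0 :=
    hder.self_of_nhds
  filter_upwards [nhdsWithin_le_nhds hder, self_mem_nhdsWithin] with t ht ht0
  rw [slope_def_field]
  rcases lt_or_gt_of_ne (show t ≠ 0 from ht0) with htn | htp
  · have h3 := hconv.le_slope_of_hasDerivAt (Set.mem_univ t) (Set.mem_univ 0) htn ht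
    have h4 := hconv.slope_le_of_hasDerivAt (Set.mem_univ t) (Set.mem_univ 0) htn h0
    exact div_nonneg_of_nonpos (by linarith) (by linarith)
  · have h3 := hconv.le_slope_of_hasDerivAt (Set.mem_univ 0) (Set.mem_univ t) htp h0
    have h4 := hconv.slope_le_of_hasDerivAt (Set.mem_univ 0) (Set.mem_univ t) htp ht
    exact div_nonneg (by linarith) (by linarith)

lemma continuousAt_hessian {φ : E → ℝ} {x : E} (h : ContDiffAt ℝ 2 φ x) :
    ContinuousAt (hessian φ) x :=
  ((contDiffAt_gradient h).fderiv_right (m := 0) (by norm_num)).continuousAt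

/-! ### Positively homogeneous functions of degree two -/

variable {φ : E → ℝ} (hhom : ∀ t : ℝ, 0 < t → ∀ x, φ (t • x) = t ^ 2 * φ x)
  (hdiff : ∀ x, x ≠ 0 → ContDiffAt ℝ 2 φ x)
include hhom hdiff

lemma gradient_pos_smul {t : ℝ} (ht : 0 < t) {x : E} (hx : x ≠ 0) :
    ∇ φ (t • x) = t • ∇ φ x := by
  have htx : t • x ≠ 0 := smul_ne_zero ht.ne' hx
  have h1 : HasFDerivAt φ (fderiv ℝ φ (t • x)) (t • x) :=
    ((hdiff _ htx).differentiableAt (by norm_num)).hasFDerivAt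
  have h2 : HasFDerivAt φ (fderiv ℝ φ x) x :=
    ((hdiff _ hx).differentiableAt (by norm_num)).hasFDerivAt
  have h3 : HasFDerivAt (fun y => φ (t • y)) (t • fderiv ℝ φ (t • x)) x := by
    refine HasFDerivAt.congr_fderiv (h1.comp x ((hasFDerivAt_id x).const_smul t)) ?_
    ext; simp
  have h4 : HasFDerivAt (fun y => φ (t • y)) (t ^ 2 • fderiv ℝ φ x) x := by
    simp_rw [hhom t ht]
    exact h2.const_mul (t ^ 2)
  have h5 := h3.unique h4
  have h6 : fderiv ℝ φ (t • x) = t • fderiv ℝ φ x := by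
    have := congrArg (fun L => t⁻¹ • L) h5
    simpa [smul_smul, ht.ne', pow_two] using this
  rw [gradient, h6, map_smul, gradient]

lemma inner_gradient_self {x : E} (hx : x ≠ 0) : ⟪∇ φ x, x⟫ = 2 * φ x := by
  have h2 : HasFDerivAt φ (fderiv ℝ φ x) ((1 : ℝ) • x) := by
    simpa using ((hdiff _ hx).differentiableAt (by norm_num)).hasFDerivAt
  have h3 : HasDerivAt (fun t : ℝ => φ (t • x)) (fderiv ℝ φ x x) 1 := by
    refine HasDerivAt.congr_deriv
      (h2.comp_hasDerivAt (1 : ℝ) ((hasDerivAt_id (1 : ℝ)).smul_const x)) ?_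
    simp
  have h4 : HasDerivAt (fun t : ℝ => t ^ 2 * φ x) (2 * φ x) 1 := by
    simpa using (hasDerivAt_pow 2 (1 : ℝ)).mul_const (φ x)
  rw [inner_gradient_left]
  refine h3.unique (h4.congr_of_eventuallyEq ?_)
  filter_upwards [lt_mem_nhds (show (0 : ℝ) < 1 by norm_num)] with t ht
  exact hhom t ht x

/-- Euler's relation for the gradient, which is homogeneous of degree one. It says that the Hessian
carries the position vector to a normal vector, which links it to the Gauss map. -/
lemma hessian_self {x : E} (hx : x ≠ 0) : hessian φ x x = ∇ φ x := by
  have h2 : HasFDerivAt (∇ φ) (hessian φ x) ((1 : ℝ) • x) := by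
    simpa using hasFDerivAt_gradient (hdiff x hx)
  have h3 : HasDerivAt (fun t : ℝ => ∇ φ (t • x)) (hessian φ x x) 1 := by
    have h : HasDerivAt (∇ φ ∘ fun t : ℝ => t • x) (hessian φ x ((1 : ℝ) • x)) 1 :=
      h2.comp_hasDerivAt (1 : ℝ) ((hasDerivAt_id (1 : ℝ)).smul_const x)
    rw [one_smul] at h
    exact h
  have h4 : HasDerivAt (fun t : ℝ => t • ∇ φ x) (∇ φ x) 1 := by
    simpa using (hasDerivAt_id (1 : ℝ)).smul_const (∇ φ x)
  refine h3.unique (h4.congr_of_eventuallyEq ?_)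
  filter_upwards [lt_mem_nhds (show (0 : ℝ) < 1 by norm_num)] with t ht
  exact gradient_pos_smul hhom hdiff ht hx

lemma hessian_pos_smul {t : ℝ} (ht : 0 < t) {x : E} (hx : x ≠ 0) :
    hessian φ (t • x) = hessian φ x := by
  have h1 := hasFDerivAt_gradient (hdiff _ (smul_ne_zero ht.ne' hx))
  have h3 : HasFDerivAt (fun y => ∇ φ (t • y)) (t • hessian φ (t • x)) x := by
    refine HasFDerivAt.congr_fderiv (h1.comp x ((hasFDerivAt_id x).const_smul t)) ?_
    ext; simp
  have h4 : HasFDerivAt (fun y => t • ∇ φ y) (t • hessian φ x) x :=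
    (hasFDerivAt_gradient (hdiff x hx)).const_smul t
  have h5 := h3.unique (h4.congr_of_eventuallyEq (by
    filter_upwards [isOpen_ne.mem_nhds hx] with y hy
    exact gradient_pos_smul hhom hdiff ht hy))
  exact smul_right_injective _ ht.ne' h5

end Hessian

/-! ### Gauges of convex bodies and their regularity -/

section ConvexBody

variable {E : Type*} [NormedAddCommGroup E] [InnerProductSpace ℝ E]

/-- A convex body with the origin in its interior. -/
structure IsBodyAroundZero (K : Set E) : Prop where
  isCompact : IsCompact K
  convex : Convex ℝ K
  zero_mem_interior : (0 : E) ∈ interior K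

/-- Half the square of the gauge function of a set. -/
noncomputable def gaugeEnergy (K : Set E) (x : E) : ℝ := gauge K x ^ 2 / 2

namespace IsBodyAroundZero

variable {K : Set E} (hK : IsBodyAroundZero K)
include hK

lemma mem_nhds_zero : K ∈ 𝓝 (0 : E) := mem_interior_iff_mem_nhds.1 hK.zero_mem_interior

lemma absorbent : Absorbent ℝ K := absorbent_nhds_zero hK.mem_nhds_zero

lemma gauge_pos {x : E} (hx : x ≠ 0) : 0 < gauge K x :=
  (_root_.gauge_pos hK.absorbent
    ((NormedSpace.isVonNBounded_iff ℝ).2 hK.isCompact.isBounded)).2 hx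

lemma gauge_le_one_iff {x : E} : gauge K x ≤ 1 ↔ x ∈ K := by
  rw [gauge_le_one_iff_mem_closure hK.convex hK.mem_nhds_zero, hK.isCompact.isClosed.closure_eq]

lemma gauge_eq_one_iff {x : E} : gauge K x = 1 ↔ x ∈ frontier K :=
  gauge_eq_one_iff_mem_frontier hK.convex hK.mem_nhds_zero

lemma continuous_gauge : Continuous (gauge K) :=
  _root_.continuous_gauge hK.convex hK.mem_nhds_zero

lemma gauge_add_le (x y : E) : gauge K (x + y) ≤ gauge K x + gauge K y :=
  _root_.gauge_add_le hK.convex hK.absorbent x y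

omit hK in
lemma gauge_pos_smul {t : ℝ} (ht : 0 ≤ t) (x : E) : gauge K (t • x) = t * gauge K x := by
  rw [gauge_smul_of_nonneg ht, smul_eq_mul]

lemma inv_gauge_smul_mem_frontier {x : E} (hx : x ≠ 0) : (gauge K x)⁻¹ • x ∈ frontier K := by
  have := hK.gauge_pos hx
  rw [← hK.gauge_eq_one_iff, gauge_pos_smul (by positivity), inv_mul_cancel₀ this.ne']

lemma ne_zero_of_mem_frontier {x : E} (hx : x ∈ frontier K) : x ≠ 0 := by
  rintro rfl
  exact hx.2 hK.zero_mem_interior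

omit hK in
lemma gaugeEnergy_pos_smul (t : ℝ) (ht : 0 < t) (x : E) :
    gaugeEnergy K (t • x) = t ^ 2 * gaugeEnergy K x := by
  rw [gaugeEnergy, gauge_pos_smul ht.le, gaugeEnergy]; ring

lemma gaugeEnergy_pos {x : E} (hx : x ≠ 0) : 0 < gaugeEnergy K x := by
  have := hK.gauge_pos hx
  rw [gaugeEnergy]; positivity

lemma convexOn_gauge : ConvexOn ℝ Set.univ (gauge K) := by
  refine ⟨convex_univ, fun x _ y _ a b ha hb _ => ?_⟩
  refine (hK.gauge_add_le _ _).trans ?_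
  rw [gauge_pos_smul ha, gauge_pos_smul hb, smul_eq_mul, smul_eq_mul]

lemma convexOn_gaugeEnergy : ConvexOn ℝ Set.univ (gaugeEnergy K) := by
  have := (hK.convexOn_gauge.pow (fun x _ => gauge_nonneg x) 2).smul
    (show (0 : ℝ) ≤ 1 / 2 by norm_num)
  refine this.congr fun x _ => ?_
  simp [gaugeEnergy]; ring

omit hK in
lemma contDiffAt_gaugeEnergy {x : E} (h : ContDiffAt ℝ 2 (gauge K) x) :
    ContDiffAt ℝ 2 (gaugeEnergy K) x := by
  unfold gaugeEnergy
  exact (h.pow 2).div_const 2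

/-- The differential of a defining function is nonpositive in directions pointing into the set. -/
lemma fderiv_sub_nonpos {f : E → ℝ} {x y : E} (hf : DifferentiableAt ℝ f x) (hx : x ∈ K)
    (hfx : f x = 0) (hfK : ∀ᶠ z in 𝓝 x, z ∈ K → f z ≤ 0) (hy : y ∈ K) :
    fderiv ℝ f x (y - x) ≤ 0 := by
  have h1 : HasDerivAt (fun t : ℝ => x + t • (y - x)) (y - x) 0 := by
    simpa using ((hasDerivAt_id (0 : ℝ)).smul_const (y - x)).const_add x
  have h0 : Filter.Tendsto (fun t : ℝ => x + t • (y - x)) (𝓝 0) (𝓝 x) := by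
    simpa using h1.continuousAt.tendsto
  have h2 : HasFDerivAt f (fderiv ℝ f x) (x + (0 : ℝ) • (y - x)) := by
    simpa using hf.hasFDerivAt
  have h3 := hasDerivAt_iff_tendsto_slope.1 (h2.comp_hasDerivAt (0 : ℝ) h1)
  have h4 := h3.mono_left (nhdsWithin_mono (0 : ℝ) (show Set.Ioi (0 : ℝ) ⊆ {0}ᶜ from
    fun t ht => (ne_of_gt ht : t ≠ 0)))
  refine le_of_tendsto h4 ?_
  filter_upwards [self_mem_nhdsWithin, nhdsWithin_le_nhds (h0.eventually hfK),
    nhdsWithin_le_nhds (gt_mem_nhds (show (0 : ℝ) < 1 by norm_num))] with t ht hft ht1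
  have ht0 : (0 : ℝ) < t := ht
  have hmem : x + t • (y - x) ∈ K := hK.convex.add_smul_sub_mem hx hy ⟨ht0.le, ht1.le⟩
  rw [slope_def_field]
  simp only [Function.comp_apply, zero_smul, add_zero, hfx, sub_zero]
  exact div_nonpos_of_nonpos_of_nonneg (hft hmem) ht0.le

/-- Near x the reciprocal of the gauge is the factor s that brings s • y to the boundary, and the
implicit function theorem solves f (s • y) = 0 for s. Transversality of the rays to the boundary
comes from the origin being interior. -/
lemma contDiffAt_gauge_of_mem_frontier [CompleteSpace E] {x : E} (hx : x ∈ frontier K)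
    {f : E → ℝ} (hf : ContDiffAt ℝ 2 f x) (hf' : fderiv ℝ f x ≠ 0)
    (hfK : ∀ᶠ y in 𝓝 x, (y ∈ K ↔ f y ≤ 0)) : ContDiffAt ℝ 2 (gauge K) x := by
  have hxK : x ∈ K := hK.isCompact.isClosed.frontier_subset hx
  have hfx : f x = 0 := by
    refine le_antisymm (hfK.self_of_nhds.1 hxK) (not_lt.1 fun hlt => hx.2 ?_)
    rw [mem_interior_iff_mem_nhds]
    filter_upwards [hfK, hf.continuousAt.eventually (gt_mem_nhds hlt)] with y hy hy'
    exact hy.2 hy'.le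
  -- For a direction u on which the differential is positive, a small multiple t • u lies in K. The
  -- differential is nonpositive at t • u - x, hence at least t times its value at u when evaluated
  -- at x.
  have hdx : 0 < fderiv ℝ f x x := by
    obtain ⟨u, hu⟩ : ∃ u, 0 < fderiv ℝ f x u := by
      obtain ⟨u, hu⟩ : ∃ u, fderiv ℝ f x u ≠ 0 := by
        by_contra! h
        exact hf' (ContinuousLinearMap.ext h)
      rcases lt_or_gt_of_ne hu with h | h
      · exact ⟨-u, by simpa using h⟩
      · exact ⟨u, h⟩
    have hlim : Filter.Tendsto (fun t : ℝ => t • u) (𝓝[>] 0) (𝓝 0) := by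
      have : Filter.Tendsto (fun t : ℝ => t • u) (𝓝 0) (𝓝 ((0 : ℝ) • u)) :=
        (continuous_id.smul continuous_const).tendsto _
      rw [zero_smul] at this
      exact this.mono_left nhdsWithin_le_nhds
    obtain ⟨t, htK, ht⟩ := ((hlim.eventually hK.mem_nhds_zero).and self_mem_nhdsWithin).exists
    have h1 := hK.fderiv_sub_nonpos (hf.differentiableAt (by norm_num)) hxK hfx
      (hfK.mono fun _ h => h.1) (show t • u ∈ K from htK)
    rw [map_sub, map_smul, smul_eq_mul] at h1
    have := mul_pos (show 0 < t from ht) hu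
    linarith
  -- A zero of f interior to K would be a local maximum of f, but the differential does not vanish
  -- near x.
  have hfront : ∀ᶠ z in 𝓝 x, f z = 0 → z ∈ frontier K := by
    have hcd : ContinuousAt (fderiv ℝ f) x :=
      (hf.fderiv_right (m := 1) (by norm_num)).continuousAt
    filter_upwards [hfK.eventually_nhds, hcd.eventually_ne hf'] with z hz hz' hfz
    refine ⟨subset_closure (hz.self_of_nhds.2 hfz.le), fun hint => hz' ?_⟩
    refine IsLocalMax.fderiv_eq_zero ?_
    filter_upwards [hz, mem_interior_iff_mem_nhds.1 hint] with y hy hyK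
    rw [hfz]
    exact hy.1 hyK
  let F : E × ℝ → ℝ := fun u => f (u.2 • u.1)
  have hF : ContDiffAt ℝ 2 F (x, 1) := by
    have h1 : ContDiffAt ℝ 2 (fun u : E × ℝ => u.2 • u.1) (x, 1) :=
      contDiffAt_snd.smul contDiffAt_fst
    have h2 : ContDiffAt ℝ 2 f ((fun u : E × ℝ => u.2 • u.1) (x, 1)) := by simpa using hf
    exact h2.comp (x, 1) h1
  have hFs : (fderiv ℝ F (x, 1)) (0, 1) = fderiv ℝ f x x := by
    have h1 : HasFDerivAt F (fderiv ℝ F (x, 1)) (x, (1 : ℝ)) :=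
      (hF.differentiableAt (by norm_num)).hasFDerivAt
    have h2 : HasDerivAt (fun s : ℝ => ((x, s) : E × ℝ)) (0, 1) 1 :=
      (hasDerivAt_const (1 : ℝ) x).prodMk (hasDerivAt_id (1 : ℝ))
    have h3 := h1.comp_hasDerivAt (1 : ℝ) h2
    have h4 : HasFDerivAt f (fderiv ℝ f x) ((1 : ℝ) • x) := by
      simpa using (hf.differentiableAt (by norm_num)).hasFDerivAt
    have h5 : HasDerivAt (f ∘ fun s : ℝ => s • x) (fderiv ℝ f x ((1 : ℝ) • x)) 1 :=
      h4.comp_hasDerivAt (1 : ℝ) ((hasDerivAt_id (1 : ℝ)).smul_const x)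
    rw [one_smul] at h5
    exact h3.unique h5
  have hinv : (fderiv ℝ F (x, 1) ∘L .inr ℝ E ℝ).IsInvertible := by
    have hne : fderiv ℝ f x x ≠ 0 := hdx.ne'
    refine ⟨ContinuousLinearEquiv.unitsEquivAut ℝ (Units.mk0 _ hne), ?_⟩
    ext
    simp [hFs]
  set s := hF.implicitFunction (by norm_num) hinv with hs
  have hs1 : s x = 1 := hF.implicitFunction_apply_self (by norm_num) hinv
  have hsC : ContDiffAt ℝ 2 s x := hF.contDiffAt_implicitFunction (by norm_num) hinv
  have hsF : ∀ᶠ y in 𝓝 x, F (y, s y) = F (x, 1) :=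
    hF.eventually_apply_implicitFunction (by norm_num) hinv
  have hlim : Filter.Tendsto (fun y => s y • y) (𝓝 x) (𝓝 x) := by
    have h : ContinuousAt (fun y => s y • y) x := hsC.continuousAt.smul continuousAt_id
    simpa [ContinuousAt, hs1] using h
  have hspos : ∀ᶠ y in 𝓝 x, 0 < s y :=
    hsC.continuousAt.eventually (lt_mem_nhds (by rw [hs1]; norm_num))
  have key : gauge K =ᶠ[𝓝 x] fun y => (s y)⁻¹ := by
    filter_upwards [hsF, hlim.eventually hfront, hspos] with y h1 h2 h3
    have h4 : f (s y • y) = 0 := by simpa [F, hfx] using h1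
    have h5 := hK.gauge_eq_one_iff.2 (h2 h4)
    rw [gauge_pos_smul h3.le] at h5
    exact eq_inv_of_mul_eq_one_right h5
  exact (hsC.inv (by rw [hs1]; norm_num)).congr_of_eventuallyEq key

end IsBodyAroundZero

/-- A convex body around the origin whose gauge is of class `C²` away from the origin. -/
structure IsC2Body (K : Set E) : Prop extends IsBodyAroundZero K where
  contDiffAt_gauge : ∀ x, x ≠ 0 → ContDiffAt ℝ 2 (gauge K) x

namespace IsC2Body

variable {K : Set E} (hK : IsC2Body K)
include hK

lemma contDiffAt_gaugeEnergy (x : E) (hx : x ≠ 0) : ContDiffAt ℝ 2 (gaugeEnergy K) x :=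
  IsBodyAroundZero.contDiffAt_gaugeEnergy (hK.contDiffAt_gauge x hx)

variable [CompleteSpace E]

lemma hasGradientAt_gauge {x : E} (hx : x ≠ 0) : HasGradientAt (gauge K) (∇ (gauge K) x) x :=
  ((hK.contDiffAt_gauge x hx).differentiableAt (by norm_num)).hasGradientAt

lemma gradient_gaugeEnergy {x : E} (hx : x ≠ 0) :
    ∇ (gaugeEnergy K) x = gauge K x • ∇ (gauge K) x := by
  have h1 := (hK.hasGradientAt_gauge hx).hasFDerivAt
  have h2 : HasFDerivAt (gaugeEnergy K)
      (InnerProductSpace.toDual ℝ E (gauge K x • ∇ (gauge K) x)) x := by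
    refine ((h1.pow 2).mul_const (2⁻¹ : ℝ)).congr_fderiv ?_
    ext y
    simp
    ring
  exact (hasGradientAt_iff_hasFDerivAt.2 h2).gradient

lemma inner_gradient_gauge_self {x : E} (hx : x ≠ 0) : ⟪∇ (gauge K) x, x⟫ = gauge K x := by
  have h := inner_gradient_self IsBodyAroundZero.gaugeEnergy_pos_smul hK.contDiffAt_gaugeEnergy hx
  rw [hK.gradient_gaugeEnergy hx, real_inner_smul_left, gaugeEnergy] at h
  have := hK.gauge_pos hx
  have h2 : gauge K x * ⟪∇ (gauge K) x, x⟫ = gauge K x * gauge K x := by linarith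
  exact mul_left_cancel₀ this.ne' h2

/-- By Euler's relation the gradient pairs with x to the positive number `gauge K x`. -/
lemma gradient_gauge_ne_zero {x : E} (hx : x ≠ 0) : ∇ (gauge K) x ≠ 0 := by
  intro h
  have := hK.inner_gradient_gauge_self hx
  rw [h, inner_zero_left] at this
  exact (hK.gauge_pos hx).ne this

/-- The gauge lies above its linearizations. -/
lemma inner_gradient_gauge_le {x : E} (hx : x ≠ 0) (y : E) :
    ⟪∇ (gauge K) x, y⟫ ≤ gauge K y := by
  have hline : HasDerivAt (fun t : ℝ => x + t • y) y 0 := by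
    simpa using ((hasDerivAt_id (0 : ℝ)).smul_const y).const_add x
  have h1 : HasFDerivAt (gauge K) (InnerProductSpace.toDual ℝ E (∇ (gauge K) x))
      (x + (0 : ℝ) • y) := by simpa using (hK.hasGradientAt_gauge hx).hasFDerivAt
  have h2 := (hasDerivAt_iff_tendsto_slope.1 (h1.comp_hasDerivAt (0 : ℝ) hline)).mono_left
    (nhdsWithin_mono (0 : ℝ) (show Set.Ioi (0 : ℝ) ⊆ {0}ᶜ from
    fun t ht => (ne_of_gt ht : t ≠ 0)))
  simp only [InnerProductSpace.toDual_apply_apply] at h2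
  refine le_of_tendsto h2 ?_
  filter_upwards [self_mem_nhdsWithin] with t ht
  have ht0 : (0 : ℝ) < t := ht
  rw [slope_def_field, div_le_iff₀ (by linarith)]
  have := hK.gauge_add_le x (t • y)
  rw [IsBodyAroundZero.gauge_pos_smul ht0.le] at this
  simp
  linarith

/-- A linear functional dominated by a multiple of the gauge, with equality at `x`, is that multiple
of the gradient of the gauge at `x`. -/
lemma eq_smul_gradient_gauge {x u : E} (hx : x ≠ 0) {m : ℝ}
    (hle : ∀ y, ⟪y, u⟫ ≤ m * gauge K y) (heq : ⟪x, u⟫ = m * gauge K x) :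
    u = m • ∇ (gauge K) x := by
  set N := ∇ (gauge K) x
  have h1 : HasFDerivAt (fun y => m * gauge K y - ⟪y, u⟫)
      (m • InnerProductSpace.toDual ℝ _ N - InnerProductSpace.toDual ℝ _ u) x := by
    have h2 := (hK.hasGradientAt_gauge hx).hasFDerivAt.const_mul m
    have h3 := (InnerProductSpace.toDual ℝ E u).hasFDerivAt (x := x)
    refine (h2.sub h3).congr_of_eventuallyEq (.of_forall fun y => ?_)
    simp [real_inner_comm]
  have hmin : IsLocalMin (fun y => m * gauge K y - ⟪y, u⟫) x := by
    refine .of_forall fun y => ?_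
    have := hle y
    simp only
    linarith
  have h4 := hmin.hasFDerivAt_eq_zero h1
  have h5 : (InnerProductSpace.toDual ℝ E) (m • N - u) = 0 := by
    simpa using h4
  rw [map_eq_zero_iff _ (LinearIsometryEquiv.injective _), sub_eq_zero] at h5
  exact h5.symm

end IsC2Body

end ConvexBody

namespace CentroAffine

lemma isC2Body_of_hasC2Boundary {n : ℕ} {K : Set (EuclideanSpace ℝ (Fin n))}
    (hK : IsBodyAroundZero K) (hC2 : HasC2Boundary K) : IsC2Body K := by
  refine ⟨hK, fun x hx => ?_⟩
  have hpos := hK.gauge_pos hx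
  obtain ⟨f, hf, hf', hfK⟩ := hC2 _ (hK.inv_gauge_smul_mem_frontier hx)
  have h1 := hK.contDiffAt_gauge_of_mem_frontier (hK.inv_gauge_smul_mem_frontier hx) hf hf' hfK
  -- Homogeneity transports regularity from the boundary point on the ray of x to x itself.
  have h2 : ContDiffAt ℝ 2 (fun y => gauge K x * gauge K ((gauge K x)⁻¹ • y)) x :=
    contDiffAt_const.mul 
      (h1.comp x (by fun_prop : ContDiffAt ℝ 2 (fun y => (gauge K x)⁻¹ • y) x))
  refine h2.congr_of_eventuallyEq (.of_forall fun y => ?_)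
  beta_reduce
  rw [IsBodyAroundZero.gauge_pos_smul (by positivity)]
  field_simp

end CentroAffine

/-! ### Determinants and compressions -/

section Determinant

variable {E : Type*} [NormedAddCommGroup E] [InnerProductSpace ℝ E] [FiniteDimensional ℝ E]

/-- The determinant of an endomorphism with eigenvector `u` is the eigenvalue times the determinant
of the compression to the orthogonal complement of `u`. -/
lemma LinearMap.det_eq_mul_det_compression (L : E →ₗ[ℝ] E) {u : E} (hu : u ≠ 0) {a : ℝ}
    (hL : L u = a • u) :
    LinearMap.det L = a * LinearMap.det (((Submodule.span ℝ {u})ᗮ.orthogonalProjectionOnto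
      : E →ₗ[ℝ] (Submodule.span ℝ {u})ᗮ) ∘ₗ L ∘ₗ (Submodule.span ℝ {u})ᗮ.subtype) := by
  set W := Submodule.span ℝ {u} with hW
  have hmem : ∀ w ∈ W, L w = a • w := by
    intro w hw
    obtain ⟨c, rfl⟩ := Submodule.mem_span_singleton.1 hw
    rw [map_smul, hL, smul_comm]
  have he : ∀ w ∈ W, L w ∈ W := fun w hw => by
    rw [hmem w hw]
    exact W.smul_mem a hw
  have h1 : L.restrict he = a • LinearMap.id := by
    ext w
    simpa using hmem w w.2
  -- L is block triangular relative to the invariant line W. The block on W is the scalar a, and the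
  -- block on the quotient is the compression once the quotient is identified with the orthogonal
  -- complement.
  rw [LinearMap.det_eq_det_mul_det W L he, h1, LinearMap.det_smul, LinearMap.det_id,
    finrank_span_singleton hu, pow_one, mul_one,
    ← LinearMap.det_conj (W.mapQ W L he) W.quotientEquivOrthogonal.toLinearEquiv]
  congr 2
  ext t : 1
  have h2 : W.quotientEquivOrthogonal.toLinearEquiv.symm t = W.mkQ (t : E) := by
    simp [Submodule.toLinearEquiv_quotientEquivOrthogonal]
  simp only [LinearMap.comp_apply, LinearEquiv.coe_coe, h2, Submodule.mkQ_apply,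
    Submodule.mapQ_apply]
  rw [Submodule.toLinearEquiv_quotientEquivOrthogonal]
  rw [Submodule.quotientEquivOfIsCompl_apply_mk]
  change _ = Wᗮ.orthogonalProjectionOnto (L t)
  obtain ⟨y, hy, z, hz, hyz⟩ := W.exists_add_mem_mem_orthogonal (L t)
  change Wᗮ.projectionOnto W _ (L t) = _
  rw [hyz, map_add, map_add,
    Submodule.orthogonalProjectionOnto_apply_of_mem_orthogonal (K := Wᗮ) 
      (Submodule.le_orthogonal_orthogonal W hy),
    (Submodule.projectionOnto_apply_eq_zero_iff _).2 hy]
  congr 1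
  rw [Submodule.projectionOnto_apply_of_mem_left _ hz]
  exact (Wᗮ.orthogonalProjectionOnto_mem_subspace_eq_self ⟨z, hz⟩).symm

end Determinant

/-! ### Centro-affine curvature as a Hessian determinant -/

section Gauss

variable {n : ℕ} {K : Set (EuclideanSpace ℝ (Fin n))} (hK : IsC2Body K)
include hK
open CentroAffine

lemma IsC2Body.gradient_gaugeEnergy_ne_zero {x : EuclideanSpace ℝ (Fin n)} (hx : x ≠ 0) :
    ∇ (gaugeEnergy K) x ≠ 0 := by
  rw [hK.gradient_gaugeEnergy hx]
  exact smul_ne_zero (hK.gauge_pos hx).ne' (hK.gradient_gauge_ne_zero hx)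

/-- The gradient of the gauge is a supporting functional of K at x. Since the gauge is
differentiable, every other one is a multiple of it, so the unit length fixes the value chosen by
`Classical.epsilon`. -/
lemma IsC2Body.gaussMap_eq {x : EuclideanSpace ℝ (Fin n)} (hx : x ∈ frontier K) :
    gaussMap K x = ‖∇ (gaugeEnergy K) x‖⁻¹ • ∇ (gaugeEnergy K) x := by
  have hx0 := hK.ne_zero_of_mem_frontier hx
  have hgx : gauge K x = 1 := hK.gauge_eq_one_iff.2 hx
  have hN : ∇ (gaugeEnergy K) x = ∇ (gauge K) x := by
    rw [hK.gradient_gaugeEnergy hx0, hgx, one_smul]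
  have hN0 := hK.gradient_gaugeEnergy_ne_zero hx0
  rw [hN] at hN0 ⊢
  set N := ∇ (gauge K) x
  have hNpos : 0 < ‖N‖ := norm_pos_iff.2 hN0
  have hxN : ⟪x, N⟫ = 1 := by
    rw [real_inner_comm, hK.inner_gradient_gauge_self hx0, hgx]
  have hex : IsOuterUnitNormal K x (‖N‖⁻¹ • N) := by
    refine ⟨by rw [norm_smul, norm_inv, norm_norm, inv_mul_cancel₀ hNpos.ne'], fun y hy => ?_⟩
    rw [real_inner_smul_right, real_inner_smul_right, hxN, real_inner_comm]
    have := (hK.inner_gradient_gauge_le hx0 y).trans (hK.gauge_le_one_iff.2 hy)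
    gcongr
  have hspec : IsOuterUnitNormal K x (gaussMap K x) := Classical.epsilon_spec ⟨_, hex⟩
  set u := gaussMap K x
  have hle : ∀ y, ⟪y, u⟫ ≤ ⟪x, u⟫ * gauge K y := by
    intro y
    by_cases hy : y = 0
    · simp [hy, gauge_zero]
    have hg := hK.gauge_pos hy
    have h1 := hspec.2 _ (hK.isCompact.isClosed.frontier_subset (hK.inv_gauge_smul_mem_frontier hy))
    rw [real_inner_smul_left, inv_mul_le_iff₀ hg] at h1
    linarith
  have hu : u = ⟪x, u⟫ • N := hK.eq_smul_gradient_gauge hx0 hle (by rw [hgx, mul_one])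
  have hm : 0 ≤ ⟪x, u⟫ := by
    simpa using hspec.2 0 (interior_subset hK.zero_mem_interior)
  have hm1 : ⟪x, u⟫ = ‖N‖⁻¹ := by
    have h1 := hspec.1
    rw [hu, norm_smul, Real.norm_of_nonneg hm] at h1
    exact eq_inv_of_mul_eq_one_left h1
  rw [← hm1]; exact hu

lemma IsC2Body.gaussMap_radialProjection {y : EuclideanSpace ℝ (Fin n)} (hy : y ≠ 0) :
    gaussMap K (radialProjection K y) =
      ‖∇ (gaugeEnergy K) y‖⁻¹ • ∇ (gaugeEnergy K) y := by
  have hg := hK.gauge_pos hy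
  rw [radialProjection, hK.gaussMap_eq (hK.inv_gauge_smul_mem_frontier hy),
    gradient_pos_smul IsBodyAroundZero.gaugeEnergy_pos_smul hK.contDiffAt_gaugeEnergy
      (inv_pos.2 hg) hy, norm_smul, smul_smul, norm_inv, Real.norm_of_nonneg hg.le]
  congr 1
  field_simp

/-- The centro-affine curvature is the Hessian determinant of half the squared gauge. -/
lemma IsC2Body.centroAffineCurvature_eq {x : EuclideanSpace ℝ (Fin n)} (hx : x ∈ frontier K) :
    centroAffineCurvature K x = (hessian (gaugeEnergy K) x).det := by
  have hx0 := hK.ne_zero_of_mem_frontier hx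
  have hgx : gauge K x = 1 := hK.gauge_eq_one_iff.2 hx
  have hν := hK.gaussMap_eq hx
  have hN0 := hK.gradient_gaugeEnergy_ne_zero hx0
  have hxN : ⟪∇ (gaugeEnergy K) x, x⟫ = 1 := by
    rw [hK.gradient_gaugeEnergy hx0, hgx, one_smul, hK.inner_gradient_gauge_self hx0, hgx]
  set H := hessian (gaugeEnergy K) x with hH
  have hHx : H x = ∇ (gaugeEnergy K) x :=
    hessian_self IsBodyAroundZero.gaugeEnergy_pos_smul hK.contDiffAt_gaugeEnergy hx0
  have hder := hasFDerivAt_gradient (hK.contDiffAt_gaugeEnergy x hx0)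
  rw [← hH] at hder
  set N := ∇ (gaugeEnergy K) x with hN
  have hNpos : 0 < ‖N‖ := norm_pos_iff.2 hN0
  set ν := gaussMap K x with hνdef
  have hν0 : ν ≠ 0 := by rw [hν]; exact smul_ne_zero (inv_pos.2 hNpos).ne' hN0
  have hNν : N = ‖N‖ • ν := by rw [hν, smul_smul, mul_inv_cancel₀ hNpos.ne', one_smul]
  have hνν : ‖ν‖ = 1 := by
    rw [hν, norm_smul, norm_inv, norm_norm, inv_mul_cancel₀ hNpos.ne']
  have hνx : ⟪ν, x⟫ = ‖N‖⁻¹ := by rw [hν, real_inner_smul_left, hxN, mul_one]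
  set T := tangentSpace K x with hT
  have hTν : T = (Submodule.span ℝ {ν})ᗮ := rfl
  set D := LinearMap.det ((T.orthogonalProjectionOnto : _ →ₗ[ℝ] T) ∘ₗ
    (H : _ →ₗ[ℝ] EuclideanSpace ℝ (Fin n)) ∘ₗ T.subtype) with hD
  have hPN : T.orthogonalProjectionOnto N = 0 := by
    rw [hNν, map_smul, hTν, Submodule.orthogonalProjectionOnto_orthogonalComplement_singleton_eq_zero,
      smul_zero]
  -- Differentiating N/‖N‖, the derivative of the normalizing factor contributes a multiple of N,
  -- which the projection to the tangent space kills.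
  have hW : weingartenMap K x = ‖N‖⁻¹ • ((T.orthogonalProjectionOnto : _ →ₗ[ℝ] T) ∘ₗ
    (H : _ →ₗ[ℝ] EuclideanSpace ℝ (Fin n)) ∘ₗ T.subtype) := by
    have h1 : DifferentiableAt ℝ (fun y => ‖∇ (gaugeEnergy K) y‖⁻¹) x :=
      (hder.differentiableAt.norm ℝ hN0).inv hNpos.ne'
    have h2 := h1.hasFDerivAt.smul hder
    have h3 : HasFDerivAt (fun y => gaussMap K (radialProjection K y)) _ x :=
      h2.congr_of_eventuallyEq (by
        filter_upwards [isOpen_ne.mem_nhds hx0] with y hy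
        exact hK.gaussMap_radialProjection hy)
    ext1 t
    rw [weingartenMap, h3.fderiv]
    have : T.orthogonalProjectionOnto (‖N‖⁻¹ • H t + (fderiv ℝ (fun y => ‖∇ (gaugeEnergy K) y‖⁻¹) x t) • N) =
       ‖N‖⁻¹ • T.orthogonalProjectionOnto (H t) := by
      rw [map_add, map_smul, map_smul, hPN, smul_zero, add_zero]
    exact this
  have hfin : Module.finrank ℝ T + 1 = n := by
    have := Submodule.finrank_add_finrank_orthogonal (Submodule.span ℝ {ν})
    rw [finrank_span_singleton hν0, finrank_euclideanSpace_fin] at this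
    rw [hTν]; omega
  -- The Hessian maps x, not ν, to a normal vector. The transvection C moves ν to x and fixes the
  -- tangent space, so H ∘ C has ν as an eigenvector and the same compression as H; its determinant
  -- is ⟪ν, x⟫.
  have hdet : H.det * ‖N‖⁻¹ = ‖N‖ * D := by
    set C := LinearMap.transvection (innerSL ℝ ν : _ →ₗ[ℝ] ℝ) (x - ν) with hC
    have hCdet : LinearMap.det C = ‖N‖⁻¹ := by
      rw [hC, LinearMap.transvection.det]
      simp [inner_sub_right, hνx, hνν]
    have hCν : C ν = x := by
      simp [hC, LinearMap.transvection.apply, hνν]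
    have hHC : ((H : _ →ₗ[ℝ] EuclideanSpace ℝ (Fin n)) ∘ₗ C) ν = ‖N‖ • ν := by
      rw [LinearMap.comp_apply, hCν, ← hNν]; exact hHx
    have h1 := LinearMap.det_eq_mul_det_compression _ hν0 hHC
    rw [LinearMap.det_comp, hCdet] at h1
    have h2 : ((H : _ →ₗ[ℝ] EuclideanSpace ℝ (Fin n)) ∘ₗ C) ∘ₗ (Submodule.span ℝ {ν})ᗮ.subtype =
        (H : _ →ₗ[ℝ] EuclideanSpace ℝ (Fin n)) ∘ₗ (Submodule.span ℝ {ν})ᗮ.subtype := by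
      ext1 t
      have ht : ⟪ν, (t : EuclideanSpace ℝ (Fin n))⟫ = 0 :=
        Submodule.mem_orthogonal_singleton_iff_inner_right.1 t.2
      simp [hC, LinearMap.transvection.apply, ht]
    rw [h2] at h1
    exact h1
  rw [centroAffineCurvature, gaussCurvature, hW, LinearMap.det_smul, ← hνdef, real_inner_comm, hνx,
    ← hD]
  -- The Weingarten determinant carries ‖N‖⁻¹ to the power n - 1, and ⟪x, ν⟫ = ‖N‖⁻¹ is taken to the
  -- power n + 1. The two surplus factors are those in `H.det = ‖N‖ ^ 2 * D`.
  have hpow : ‖N‖⁻¹ ^ (n + 1) = ‖N‖⁻¹ ^ Module.finrank ℝ T * ‖N‖⁻¹ ^ 2 := by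
    rw [← pow_add]; congr 1; omega
  have : H.det = ‖N‖ ^ 2 * D := by
    field_simp at hdet
    linarith
  rw [hpow, this]
  field_simp
  exact mul_comm _ _

end Gauss

/-- A body with `C²` gauge whose half squared gauge has positive Hessian determinant away from the
origin. -/
structure IsC2PlusBody {E : Type*} [NormedAddCommGroup E] [InnerProductSpace ℝ E] [CompleteSpace E]
    (K : Set E) : Prop extends IsC2Body K where
  det_pos : ∀ x, x ≠ 0 → 0 < (hessian (gaugeEnergy K) x).det

lemma contDiffAt_two_of_gradient {E : Type*} [NormedAddCommGroup E] [InnerProductSpace ℝ E]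
    [CompleteSpace E] {φ : E → ℝ} {ψ : E → E} {y : E} (hψ : ContDiffAt ℝ 1 ψ y)
    (h : ∀ᶠ z in 𝓝 y, HasGradientAt φ (ψ z) z) : ContDiffAt ℝ 2 φ y := by
  have h2 : ContDiffAt ℝ ((1 : ℕ) + 1) φ y := by
    rw [contDiffAt_succ_iff_hasFDerivAt]
    obtain ⟨u, hu, hmem⟩ := h.exists_mem
    exact ⟨fun z => InnerProductSpace.toDual ℝ E (ψ z), ⟨u, hu, fun z hz => (hmem z hz).hasFDerivAt⟩,
      (InnerProductSpace.toDual ℝ E).toContinuousLinearEquiv.contDiff.contDiffAt.comp y hψ⟩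
  exact h2.of_le (by norm_num)

/-! ### Polar duality through the Legendre transform -/

section Polar

open CentroAffine

variable {n : ℕ} {K : Set (EuclideanSpace ℝ (Fin n))}

local notation "𝔼" => EuclideanSpace ℝ (Fin n)

lemma IsBodyAroundZero.polarBody (hK : IsBodyAroundZero K) :
    IsBodyAroundZero (polarBody K) := by
  have hset : CentroAffine.polarBody K = ⋂ x ∈ K, {y : 𝔼 | ⟪x, y⟫ ≤ 1} := by
    ext; simp [CentroAffine.polarBody]
  obtain ⟨r, hr, hrK⟩ := Metric.mem_nhds_iff.1 hK.mem_nhds_zero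
  obtain ⟨R, hR⟩ := hK.isCompact.isBounded.subset_closedBall (0 : 𝔼)
  refine ⟨?_, ?_, ?_⟩
  · refine Metric.isCompact_of_isClosed_isBounded ?_ ?_
    · rw [hset]
      exact isClosed_biInter fun x _ => isClosed_le (by fun_prop) continuous_const
    · refine (Metric.isBounded_closedBall (x := (0 : 𝔼)) (r := 2 / r)).subset fun y hy => ?_
      rw [mem_closedBall_zero_iff]
      rcases eq_or_ne y 0 with rfl | hy0
      · simp; positivity
      have hyn : 0 < ‖y‖ := norm_pos_iff.2 hy0
      have h1 : (r / 2 * ‖y‖⁻¹) • y ∈ K := by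
        refine hrK ?_
        rw [mem_ball_zero_iff, norm_smul, Real.norm_of_nonneg (by positivity), mul_assoc,
          inv_mul_cancel₀ hyn.ne']
        linarith
      have h2 := hy _ h1
      rw [real_inner_smul_left, real_inner_self_eq_norm_sq] at h2
      rw [le_div_iff₀ hr]
      field_simp at h2
      linarith
  · intro y hy z hz a b ha hb hab x hx
    rw [inner_add_right, real_inner_smul_right, real_inner_smul_right]
    have h1 := mul_le_mul_of_nonneg_left (hy x hx) ha
    have h2 := mul_le_mul_of_nonneg_left (hz x hx) hb
    linarith
  · rw [mem_interior_iff_mem_nhds]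
    refine Filter.mem_of_superset (Metric.ball_mem_nhds (0 : 𝔼)
      (show 0 < (|R| + 1)⁻¹ by positivity)) fun y hy x hx => ?_
    rw [mem_ball_zero_iff] at hy
    have h1 : ‖x‖ ≤ |R| + 1 := by
      have := mem_closedBall_zero_iff.1 (hR hx)
      have := le_abs_self R
      linarith
    calc ⟪x, y⟫ ≤ ‖x‖ * ‖y‖ := real_inner_le_norm x y
      _ ≤ (|R| + 1) * (|R| + 1)⁻¹ := by gcongr
      _ = 1 := mul_inv_cancel₀ (by positivity)

lemma IsBodyAroundZero.inner_le_gauge_mul_gauge_polarBody (hK : IsBodyAroundZero K) (x y : 𝔼) :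
    ⟪x, y⟫ ≤ gauge K x * gauge (CentroAffine.polarBody K) y := by
  rcases eq_or_ne x 0 with rfl | hx
  · simp [gauge_zero]
  rcases eq_or_ne y 0 with rfl | hy
  · simp [gauge_zero]
  have hgx := hK.gauge_pos hx
  have hgy := hK.polarBody.gauge_pos hy
  have h1 := hK.polarBody.isCompact.isClosed.frontier_subset
    (hK.polarBody.inv_gauge_smul_mem_frontier hy) _
    (hK.isCompact.isClosed.frontier_subset (hK.inv_gauge_smul_mem_frontier hx))
  rw [real_inner_smul_left, real_inner_smul_right, inv_mul_le_iff₀ hgx, inv_mul_le_iff₀ hgy] at h1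
  linarith

namespace IsC2Body

variable (hK : IsC2Body K)
include hK

/-- The gradient of the gauge lies in the polar body because the gauge dominates its linearizations.
It lies on the boundary because its pairing with x attains the Cauchy–Schwarz type bound. -/
lemma gauge_polarBody_gradient {x : 𝔼} (hx : x ≠ 0) :
    gauge (CentroAffine.polarBody K) (∇ (gaugeEnergy K) x) = gauge K x := by
  have hg := hK.gauge_pos hx
  have h1 : ∇ (gauge K) x ∈ CentroAffine.polarBody K := fun y hy => by
    rw [real_inner_comm]
    exact (hK.inner_gradient_gauge_le hx y).trans (hK.gauge_le_one_iff.2 hy)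
  have h2 := hK.polarBody.gauge_le_one_iff.2 h1
  have h3 := hK.inner_le_gauge_mul_gauge_polarBody x (∇ (gauge K) x)
  rw [real_inner_comm, hK.inner_gradient_gauge_self hx] at h3
  have h4 : 1 ≤ gauge (CentroAffine.polarBody K) (∇ (gauge K) x) :=
    le_of_mul_le_mul_left (by linarith) hg
  rw [hK.gradient_gaugeEnergy hx, IsBodyAroundZero.gauge_pos_smul hg.le, le_antisymm h2 h4, mul_one]

/-- A maximizer x over K of the pairing with y is a point where y is normal. Rescaling x by the
maximal value m gives the gradient the right length. -/
lemma exists_gradient_gaugeEnergy_eq {y : 𝔼} (hy : y ≠ 0) :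
    ∃ x, x ≠ 0 ∧ ∇ (gaugeEnergy K) x = y := by
  obtain ⟨x, hxK, hmax⟩ := hK.isCompact.exists_isMaxOn
    ⟨0, interior_subset hK.zero_mem_interior⟩
    (show ContinuousOn (fun x : 𝔼 => ⟪x, y⟫) K by fun_prop)
  have hmax' : ∀ z ∈ K, ⟪z, y⟫ ≤ ⟪x, y⟫ := fun z hz => hmax hz
  set m := ⟪x, y⟫ with hm
  have hyg := hK.gauge_pos hy
  have hmpos : 0 < m := by
    refine lt_of_lt_of_le ?_ (hmax' _ (hK.isCompact.isClosed.frontier_subset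
      (hK.inv_gauge_smul_mem_frontier hy)))
    rw [real_inner_smul_left]
    have := real_inner_self_pos.2 hy
    positivity
  have hx0 : x ≠ 0 := by
    rintro rfl
    simp [hm] at hmpos
  have hle : ∀ z, ⟪z, y⟫ ≤ m * gauge K z := by
    intro z
    rcases eq_or_ne z 0 with rfl | hz
    · simp [gauge_zero]
    have hg := hK.gauge_pos hz
    have h1 := hmax' _ (hK.isCompact.isClosed.frontier_subset (hK.inv_gauge_smul_mem_frontier hz))
    rw [real_inner_smul_left, inv_mul_le_iff₀ hg] at h1
    linarith
  have hgx : gauge K x = 1 := by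
    refine le_antisymm (hK.gauge_le_one_iff.2 hxK) ?_
    have := hle x
    rw [← hm] at this
    exact le_of_mul_le_mul_left (by linarith) hmpos
  refine ⟨m • x, smul_ne_zero hmpos.ne' hx0, ?_⟩
  rw [gradient_pos_smul IsBodyAroundZero.gaugeEnergy_pos_smul hK.contDiffAt_gaugeEnergy hmpos hx0,
    hK.gradient_gaugeEnergy hx0, hgx, one_smul]
  exact (hK.eq_smul_gradient_gauge hx0 hle (by rw [hgx, mul_one])).symm

end IsC2Body

namespace IsC2PlusBody

variable (hK : IsC2PlusBody K)
include hK

/-- The Hessian of half the squared gauge, as an equivalence. -/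
noncomputable def hessianEquiv {x : 𝔼} (hx : x ≠ 0) : 𝔼 ≃L[ℝ] 𝔼 :=
  ContinuousLinearMap.toContinuousLinearEquivOfDetNeZero (hessian (gaugeEnergy K) x)
    (hK.det_pos x hx).ne'

lemma coe_hessianEquiv {x : 𝔼} (hx : x ≠ 0) :
    (hK.hessianEquiv hx : 𝔼 →L[ℝ] 𝔼) = hessian (gaugeEnergy K) x := by
  ext1 v
  rfl

lemma exists_localInverse_gradient {x : 𝔼} (hx : x ≠ 0) :
    ∃ ψ : 𝔼 → 𝔼, ContDiffAt ℝ 1 ψ (∇ (gaugeEnergy K) x) ∧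
      ∀ᶠ z in 𝓝 (∇ (gaugeEnergy K) x), ψ z ≠ 0 ∧ ∇ (gaugeEnergy K) (ψ z) = z := by
  have hcd := contDiffAt_gradient (hK.contDiffAt_gaugeEnergy x hx)
  have hder : HasFDerivAt (∇ (gaugeEnergy K)) (hK.hessianEquiv hx : 𝔼 →L[ℝ] 𝔼) x := by
    rw [coe_hessianEquiv]
    exact hasFDerivAt_gradient (hK.contDiffAt_gaugeEnergy x hx)
  have hstrict := hcd.hasStrictFDerivAt' hder (by norm_num)
  have hψ := hcd.to_localInverse hder (by norm_num)
  refine ⟨hcd.localInverse hder (by norm_num), hψ, ?_⟩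
  have h1 := hψ.continuousAt.eventually_ne (y := 0)
    (by rw [hcd.localInverse_apply_image hder (by norm_num)]; exact hx)
  filter_upwards [h1, hstrict.eventually_right_inverse] with z hz hz'
  exact ⟨hz, hz'⟩

/-- Differentiating φ° ∘ ∇φ = φ, with φ° the energy of the polar body, and using symmetry of H = D²φ
gives H(∇φ°(∇φ(x))) = ∇φ(x) = H x. Invertibility of H cancels it. Differentiability of φ° itself
comes from a local inverse of ∇φ. -/
lemma hasGradientAt_gaugeEnergy_polarBody {x : 𝔼} (hx : x ≠ 0) :
    HasGradientAt (gaugeEnergy (CentroAffine.polarBody K)) x (∇ (gaugeEnergy K) x) := by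
  obtain ⟨ψ, hψ, hψinv⟩ := hK.exists_localInverse_gradient hx
  have hψ1 := hψinv.self_of_nhds
  have hconj : ∀ z : 𝔼, z ≠ 0 →
      gaugeEnergy (CentroAffine.polarBody K) (∇ (gaugeEnergy K) z) = gaugeEnergy K z := by
    intro z hz
    rw [gaugeEnergy, hK.gauge_polarBody_gradient hz, gaugeEnergy]
  have hdiff : DifferentiableAt ℝ (gaugeEnergy (CentroAffine.polarBody K))
      (∇ (gaugeEnergy K) x) := by
    have h1 : DifferentiableAt ℝ (gaugeEnergy K ∘ ψ) (∇ (gaugeEnergy K) x) :=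
      ((hK.contDiffAt_gaugeEnergy _ hψ1.1).differentiableAt (by norm_num)).comp _
        (hψ.differentiableAt (by norm_num))
    refine h1.congr_of_eventuallyEq ?_
    filter_upwards [hψinv] with z hz
    rw [Function.comp_apply, ← hconj _ hz.1, hz.2]
  have hg := hdiff.hasGradientAt
  have hφ : HasGradientAt (gaugeEnergy K) (∇ (gaugeEnergy K) x) x :=
    ((hK.contDiffAt_gaugeEnergy x hx).differentiableAt (by norm_num)).hasGradientAt
  have hH := hasFDerivAt_gradient (hK.contDiffAt_gaugeEnergy x hx)
  have h2 := hg.hasFDerivAt.comp x hH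
  have h3 : HasFDerivAt (gaugeEnergy (CentroAffine.polarBody K) ∘ ∇ (gaugeEnergy K))
      (InnerProductSpace.toDual ℝ 𝔼 (∇ (gaugeEnergy K) x)) x := by
    refine hφ.hasFDerivAt.congr_of_eventuallyEq ?_
    filter_upwards [isOpen_ne.mem_nhds hx] with z hz using hconj z hz
  have h4 := h2.unique h3
  have h5 : ∇ (gaugeEnergy (CentroAffine.polarBody K)) (∇ (gaugeEnergy K) x) = x := by
    refine ext_inner_right ℝ fun w => ?_
    obtain ⟨v, rfl⟩ := (hK.hessianEquiv hx).surjective w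
    have h6 := congrArg (fun L => L v) h4
    have h7 : hK.hessianEquiv hx v = hessian (gaugeEnergy K) x v := rfl
    rw [h7]
    simp only [ContinuousLinearMap.comp_apply, InnerProductSpace.toDual_apply_apply] at h6
    rw [h6, ← inner_hessian_comm (hK.contDiffAt_gaugeEnergy x hx),
      hessian_self IsBodyAroundZero.gaugeEnergy_pos_smul hK.contDiffAt_gaugeEnergy hx]
  rwa [h5] at hg

lemma gradient_polarBody_gradient {x : 𝔼} (hx : x ≠ 0) :
    ∇ (gaugeEnergy (CentroAffine.polarBody K)) (∇ (gaugeEnergy K) x) = x :=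
  (hK.hasGradientAt_gaugeEnergy_polarBody hx).gradient

lemma injOn_gradient : Set.InjOn (∇ (gaugeEnergy K)) {0}ᶜ := fun x hx y hy hxy => by
  rw [← hK.gradient_polarBody_gradient hx, hxy, hK.gradient_polarBody_gradient hy]

lemma image_gradient : ∇ (gaugeEnergy K) '' (K \ {0}) = CentroAffine.polarBody K \ {0} := by
  ext y
  constructor
  · rintro ⟨x, ⟨hxK, hx0⟩, rfl⟩
    refine ⟨hK.polarBody.gauge_le_one_iff.1 ?_, hK.gradient_gaugeEnergy_ne_zero hx0⟩
    rw [hK.gauge_polarBody_gradient hx0]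
    exact hK.gauge_le_one_iff.2 hxK
  · rintro ⟨hyK, hy0⟩
    obtain ⟨x, hx0, rfl⟩ := hK.exists_gradient_gaugeEnergy_eq hy0
    refine ⟨x, ⟨hK.gauge_le_one_iff.1 ?_, hx0⟩, rfl⟩
    rw [← hK.gauge_polarBody_gradient hx0]
    exact hK.polarBody.gauge_le_one_iff.2 hyK

/-- The gradient of the polar energy is the local inverse of ∇φ, which is C¹ by the inverse function
theorem. So the energy is C², and its square root is C² where it is positive. -/
lemma isC2Body_polarBody : IsC2Body (CentroAffine.polarBody K) := by
  refine ⟨hK.polarBody, fun y hy => ?_⟩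
  obtain ⟨x, hx, rfl⟩ := hK.exists_gradient_gaugeEnergy_eq hy
  obtain ⟨ψ, hψ, hψinv⟩ := hK.exists_localInverse_gradient hx
  have h2 : ContDiffAt ℝ 2 (gaugeEnergy (CentroAffine.polarBody K)) (∇ (gaugeEnergy K) x) := by
    refine contDiffAt_two_of_gradient hψ (hψinv.mono fun z hz => ?_)
    have := hK.hasGradientAt_gaugeEnergy_polarBody hz.1
    rwa [hz.2] at this
  have hpos := hK.polarBody.gaugeEnergy_pos hy
  have h3 : gauge (CentroAffine.polarBody K) =
      fun z => Real.sqrt (2 * gaugeEnergy (CentroAffine.polarBody K) z) := by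
    ext z
    rw [gaugeEnergy, mul_div_cancel₀ _ (two_ne_zero' ℝ), Real.sqrt_sq (gauge_nonneg z)]
  rw [h3]
  exact (contDiffAt_const.mul h2).sqrt (by positivity)

/-- The two gradient maps are mutually inverse, so their differentials at corresponding points are
too. -/
lemma det_hessian_polarBody {x : 𝔼} (hx : x ≠ 0) :
    (hessian (gaugeEnergy (CentroAffine.polarBody K)) (∇ (gaugeEnergy K) x)).det =
      (hessian (gaugeEnergy K) x).det⁻¹ := by
  have h1 := hasFDerivAt_gradient (hK.isC2Body_polarBody.contDiffAt_gaugeEnergy _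
    (hK.gradient_gaugeEnergy_ne_zero hx))
  have h2 := h1.comp x (hasFDerivAt_gradient (hK.contDiffAt_gaugeEnergy x hx))
  have h3 := h2.unique ((hasFDerivAt_id x).congr_of_eventuallyEq (by
    filter_upwards [isOpen_ne.mem_nhds hx] with z hz using hK.gradient_polarBody_gradient hz))
  have h4 := congrArg ContinuousLinearMap.det h3
  refine eq_inv_of_mul_eq_one_left ?_
  rw [ContinuousLinearMap.det, ContinuousLinearMap.det, ← LinearMap.det_comp]
  exact h4.trans LinearMap.det_id

lemma isC2PlusBody_polarBody : IsC2PlusBody (CentroAffine.polarBody K) := by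
  refine ⟨hK.isC2Body_polarBody, fun y hy => ?_⟩
  obtain ⟨x, hx, rfl⟩ := hK.exists_gradient_gaugeEnergy_eq hy
  rw [hK.det_hessian_polarBody hx]
  exact inv_pos.2 (hK.det_pos x hx)

end IsC2PlusBody

end Polar

/-! ### Chebyshev's inequality for powers of a function -/

section Chebyshev

lemma Real.sign_mul_rpow_sub_rpow_mul_sub_pos {x c s : ℝ} (hx : 0 < x) (hc : 0 < c) (hs : s ≠ 0)
    (hxc : x ≠ c) : 0 < Real.sign s * ((x ^ s - c ^ s) * (x - c)) := by
  rcases lt_or_gt_of_ne hs with hs | hs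
  · rw [Real.sign_of_neg hs]
    rcases lt_or_gt_of_ne hxc with h | h
    · have := Real.rpow_lt_rpow_of_neg hx h hs
      nlinarith [mul_pos (sub_pos.2 this) (sub_pos.2 h)]
    · have := Real.rpow_lt_rpow_of_neg hc h hs
      nlinarith [mul_pos (sub_pos.2 this) (sub_pos.2 h)]
  · rw [Real.sign_of_pos hs, one_mul]
    rcases lt_or_gt_of_ne hxc with h | h
    · exact mul_pos_of_neg_of_neg (sub_neg.2 (Real.rpow_lt_rpow hx.le h hs)) (sub_neg.2 h)
    · exact mul_pos (sub_pos.2 (Real.rpow_lt_rpow hc.le h hs)) (sub_pos.2 h)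

variable {X : Type*} [MeasurableSpace X] {μ : Measure X} [IsFiniteMeasure μ] {f : X → ℝ} {a b : ℝ}

lemma integrable_rpow_of_bounds (hf : Measurable f) (ha : 0 < a)
    (hab : ∀ᵐ x ∂μ, a ≤ f x ∧ f x ≤ b) (s : ℝ) : Integrable (fun x => f x ^ s) μ := by
  refine Integrable.of_bound (C := max (a ^ s) (b ^ s)) (hf.pow_const s).aestronglyMeasurable ?_
  filter_upwards [hab] with x hx
  have hfx : 0 < f x := ha.trans_le hx.1
  rw [Real.norm_of_nonneg (by positivity)]
  rcases le_total 0 s with hs | hs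
  · exact (Real.rpow_le_rpow hfx.le hx.2 hs).trans (le_max_right _ _)
  · exact (Real.rpow_le_rpow_of_nonpos ha hx.1 hs).trans (le_max_left _ _)

lemma integral_rpow_pos [NeZero μ] (hf : Measurable f) (ha : 0 < a)
    (hab : ∀ᵐ x ∂μ, a ≤ f x ∧ f x ≤ b) (s : ℝ) : 0 < ∫ x, f x ^ s ∂μ := by
  have hpos : ∀ᵐ x ∂μ, 0 < f x ^ s := by
    filter_upwards [hab] with x hx
    exact Real.rpow_pos_of_pos (ha.trans_le hx.1) s
  rw [integral_pos_iff_support_of_nonneg_ae (hpos.mono fun x hx => hx.le)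
    (integrable_rpow_of_bounds hf ha hab s)]
  rw [pos_iff_ne_zero]
  intro h0
  have h1 : ∀ᵐ x ∂μ, x ∉ Function.support fun x => f x ^ s := by
    rw [ae_iff]; simpa [Function.support] using h0
  obtain ⟨x, hx1, hx2⟩ := (hpos.and h1).exists
  exact hx2 hx1.ne'

/-- A Chebyshev type inequality for powers of a positive function, with its equality case. -/
lemma sign_mul_integral_rpow_div_le [NeZero μ] (hf : Measurable f) (ha : 0 < a)
    (hab : ∀ᵐ x ∂μ, a ≤ f x ∧ f x ≤ b) {s : ℝ} (hs : s ≠ 0) :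
    Real.sign s * ((∫ x, f x ^ s ∂μ) / ∫ x, f x ^ (1 + s) ∂μ) ≤
        Real.sign s * ((∫ x, f x ^ (0 : ℝ) ∂μ) / ∫ x, f x ^ (1 : ℝ) ∂μ) ∧
      (Real.sign s * ((∫ x, f x ^ s ∂μ) / ∫ x, f x ^ (1 + s) ∂μ) =
        Real.sign s * ((∫ x, f x ^ (0 : ℝ) ∂μ) / ∫ x, f x ^ (1 : ℝ) ∂μ) ↔
        ∃ c, ∀ᵐ x ∂μ, f x = c) := by
  have hint := integrable_rpow_of_bounds hf ha hab
  have hIpos := integral_rpow_pos hf ha hab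
  set I : ℝ → ℝ := fun s => ∫ x, f x ^ s ∂μ with hI
  change Real.sign s * (I s / I (1 + s)) ≤ Real.sign s * (I 0 / I 1) ∧
    (Real.sign s * (I s / I (1 + s)) = Real.sign s * (I 0 / I 1) ↔ _)
  have h0 : 0 < I 0 := hIpos 0
  have h1 : 0 < I 1 := hIpos 1
  have h2 : 0 < I (1 + s) := hIpos (1 + s)
  -- The mean of f. With this choice the terms c^s I(1) and c^s c I(0) cancel in the integral of h,
  -- leaving only I(1+s) - c I(s).
  set c := I 1 / I 0 with hc
  have hcpos : 0 < c := div_pos h1 h0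
  set h : X → ℝ := fun x => Real.sign s * ((f x ^ s - c ^ s) * (f x - c)) with hh
  have hexp : h =ᵐ[μ] fun x => Real.sign s * (f x ^ (1 + s) - c * f x ^ s
      - c ^ s * f x ^ (1 : ℝ) + c ^ s * c * f x ^ (0 : ℝ)) := by
    filter_upwards [hab] with x hx
    have hfx : 0 < f x := ha.trans_le hx.1
    rw [hh, Real.rpow_add hfx, Real.rpow_one, Real.rpow_zero]
    ring
  have hi1 : Integrable (fun x => f x ^ (1 + s) - c * f x ^ s) μ :=
    (hint (1 + s)).sub ((hint s).const_mul c)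
  have hi2 : Integrable (fun x => f x ^ (1 + s) - c * f x ^ s - c ^ s * f x ^ (1 : ℝ)) μ :=
    hi1.sub ((hint 1).const_mul (c ^ s))
  have hi3 : Integrable (fun x => f x ^ (1 + s) - c * f x ^ s - c ^ s * f x ^ (1 : ℝ)
      + c ^ s * c * f x ^ (0 : ℝ)) μ :=
    hi2.add ((hint 0).const_mul (c ^ s * c))
  have hhint : Integrable h μ := (hi3.const_mul (Real.sign s)).congr hexp.symm
  have hval : ∫ x, h x ∂μ = Real.sign s * (I (1 + s) - c * I s) := by
    rw [integral_congr_ae hexp, integral_const_mul,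
      integral_add hi2 ((hint 0).const_mul (c ^ s * c)),
      integral_sub hi1 ((hint 1).const_mul (c ^ s)),
      integral_sub (hint (1 + s)) ((hint s).const_mul c)]
    simp only [integral_const_mul]
    change Real.sign s * (I (1 + s) - c * I s - c ^ s * I 1 + c ^ s * c * I 0) = _
    have : c * I 0 = I 1 := by rw [hc]; field_simp
    rw [mul_assoc (c ^ s), this]
    ring
  have hnn : 0 ≤ᵐ[μ] h := by
    filter_upwards [hab] with x hx
    rcases eq_or_ne (f x) c with hxc | hxc
    · simp [hh, hxc]
    · exact (Real.sign_mul_rpow_sub_rpow_mul_sub_pos (ha.trans_le hx.1) hcpos hs hxc).le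
  have hdiff : Real.sign s * (I 0 / I 1) - Real.sign s * (I s / I (1 + s)) =
      (∫ x, h x ∂μ) * (I 0 / (I 1 * I (1 + s))) := by
    rw [hval, hc]
    field_simp
  have hfac : 0 < I 0 / (I 1 * I (1 + s)) := by positivity
  refine ⟨?_, ?_⟩
  · have := mul_nonneg (integral_nonneg_of_ae hnn) hfac.le
    linarith
  · have hiff : Real.sign s * (I s / I (1 + s)) = Real.sign s * (I 0 / I 1) ↔
        ∫ x, h x ∂μ = 0 := by
      rw [eq_comm, ← sub_eq_zero, hdiff, mul_eq_zero, or_iff_left hfac.ne']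
    rw [hiff, integral_eq_zero_iff_of_nonneg_ae hnn hhint]
    constructor
    · intro hz
      refine ⟨c, ?_⟩
      filter_upwards [hz, hab] with x hx hx'
      by_contra hxc
      exact (Real.sign_mul_rpow_sub_rpow_mul_sub_pos (ha.trans_le hx'.1) hcpos hs hxc).ne' hx
    · rintro ⟨d, hd⟩
      have hcd : c = d := by
        have e1 : I 1 = d * I 0 := by
          simp only [hI]
          rw [← integral_const_mul]
          refine integral_congr_ae ?_
          filter_upwards [hd] with x hx
          simp [hx]
        rw [hc, e1]; field_simp
      filter_upwards [hd] with x hx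
      simp [hh, hx, hcd]

end Chebyshev

/-! ### Affine surface areas as integrals over the body -/

section Integrals

open CentroAffine

variable {n : ℕ} {K : Set (EuclideanSpace ℝ (Fin n))}

local notation "𝔼" => EuclideanSpace ℝ (Fin n)

lemma measurable_det_hessian (φ : 𝔼 → ℝ) : Measurable fun x => (hessian φ x).det :=
  ContinuousLinearMap.continuous_det.measurable.comp (measurable_fderiv ℝ (∇ φ))

lemma IsC2Body.det_hessian_pos_smul (hK : IsC2Body K) {t : ℝ} (ht : 0 < t) {x : 𝔼} (hx : x ≠ 0) :
    (hessian (gaugeEnergy K) (t • x)).det = (hessian (gaugeEnergy K) x).det := by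
  rw [hessian_pos_smul IsBodyAroundZero.gaugeEnergy_pos_smul hK.contDiffAt_gaugeEnergy ht hx]

lemma IsC2Body.continuousOn_det_hessian (hK : IsC2Body K) :
    ContinuousOn (fun x => (hessian (gaugeEnergy K) x).det) {0}ᶜ := fun x hx =>
  (ContinuousLinearMap.continuous_det.continuousAt.comp
    (continuousAt_hessian (hK.contDiffAt_gaugeEnergy x hx))).continuousWithinAt

variable [NeZero n]

/-- The cone measure is an image under radial projection, and the Hessian determinant is constant on
rays, so the integral pulls back to K. The origin, where the projection misses the boundary, is a
null set as n is positive. -/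
lemma lpAffineSurfaceArea_coe (hK : IsC2Body K) (p : ℝ) :
    lpAffineSurfaceArea (p : OnePoint ℝ) K =
      n * ∫ x in K, (hessian (gaugeEnergy K) x).det ^ (p / (n + p)) := by
  have hrad : Measurable (radialProjection K) :=
    (hK.continuous_gauge.measurable.inv).smul measurable_id
  have h0 : ∀ᵐ y : 𝔼 ∂(volume.restrict K), y ≠ 0 :=
    ae_restrict_of_ae (by simp [ae_iff])
  have hmem : ∀ᵐ y ∂(volume.restrict K), radialProjection K y ∈ frontier K := by
    filter_upwards [h0] with y hy using hK.inv_gauge_smul_mem_frontier hy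
  have hfr : ∀ᵐ x ∂((volume.restrict K).map (radialProjection K)), x ∈ frontier K :=
    (ae_map_iff hrad.aemeasurable isClosed_frontier.measurableSet).2 hmem
  have hmeas : AEStronglyMeasurable (fun x => centroAffineCurvature K x ^ (p / (n + p)))
      ((volume.restrict K).map (radialProjection K)) := by
    refine ((measurable_det_hessian (gaugeEnergy K)).pow_const
      (p / (n + p))).aestronglyMeasurable.congr ?_
    filter_upwards [hfr] with x hx
    rw [hK.centroAffineCurvature_eq hx]
  change ∫ x, centroAffineCurvature K x ^ (p / (n + p)) ∂(coneMeasure K) = _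
  rw [coneMeasure, integral_smul_measure, integral_map hrad.aemeasurable hmeas]
  simp only [ENNReal.toReal_natCast, smul_eq_mul]
  congr 1
  refine integral_congr_ae ?_
  filter_upwards [h0, hmem] with y hy hy'
  rw [hK.centroAffineCurvature_eq hy', radialProjection,
    hK.det_hessian_pos_smul (inv_pos.2 (hK.gauge_pos hy)) hy]

/-- Change of variables by the gradient map: its Jacobian is the determinant f for K, and the polar
determinant is 1/f, so the integrand becomes f · f^(-s). -/
lemma integral_det_hessian_polarBody (hK : IsC2PlusBody K) (s : ℝ) :
    ∫ y in polarBody K, (hessian (gaugeEnergy (polarBody K)) y).det ^ s =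
      ∫ x in K, (hessian (gaugeEnergy K) x).det ^ (1 - s) := by
  have hae : ∀ A : Set 𝔼, (A \ {0} : Set 𝔼) =ᵐ[volume] A := fun A =>
    sdiff_null_ae_eq_self (by simp)
  have hmeas : MeasurableSet (K \ {0}) :=
    hK.isCompact.isClosed.measurableSet.diff (measurableSet_singleton 0)
  rw [← setIntegral_congr_set (hae (polarBody K)), ← setIntegral_congr_set (hae K),
    ← hK.image_gradient,
    integral_image_eq_integral_abs_det_fderiv_smul volume hmeas
      (fun x hx => (hasFDerivAt_gradient
        (hK.contDiffAt_gaugeEnergy x hx.2)).hasFDerivWithinAt)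
      (hK.injOn_gradient.mono fun x hx => hx.2)]
  refine setIntegral_congr_fun hmeas fun x hx => ?_
  have hpos := hK.det_pos x hx.2
  simp only [smul_eq_mul]
  rw [hK.det_hessian_polarBody hx.2, abs_of_pos hpos, Real.inv_rpow hpos.le,
    ← Real.rpow_neg hpos.le, sub_eq_add_neg, Real.rpow_add hpos, Real.rpow_one]

omit [NeZero n] in
lemma vol_eq_integral_rpow_zero (K : Set 𝔼) (φ : 𝔼 → ℝ) :
    vol K = ∫ x in K, (hessian φ x).det ^ (0 : ℝ) := by
  simp [vol, Measure.real]

lemma exists_bounds_det_hessian (hK : IsC2PlusBody K) :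
    ∃ a b : ℝ, 0 < a ∧ ∀ x, x ≠ 0 →
      a ≤ (hessian (gaugeEnergy K) x).det ∧ (hessian (gaugeEnergy K) x).det ≤ b := by
  have hcont : ContinuousOn (fun x => (hessian (gaugeEnergy K) x).det) (Metric.sphere (0 : 𝔼) 1) :=
    hK.continuousOn_det_hessian.mono fun x hx => by
      rintro rfl
      simp at hx
  have hne : (Metric.sphere (0 : 𝔼) 1).Nonempty := NormedSpace.sphere_nonempty.2 zero_le_one
  obtain ⟨u, hu, hmin⟩ := (isCompact_sphere (0 : 𝔼) 1).exists_isMinOn hne hcont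
  obtain ⟨v, hv, hmax⟩ := (isCompact_sphere (0 : 𝔼) 1).exists_isMaxOn hne hcont
  refine ⟨(hessian (gaugeEnergy K) u).det, (hessian (gaugeEnergy K) v).det,
    hK.det_pos u (by rintro rfl; simp at hu), fun x hx => ?_⟩
  have hxn : 0 < ‖x‖ := norm_pos_iff.2 hx
  rw [← hK.det_hessian_pos_smul (inv_pos.2 hxn) hx]
  have hmem : ‖x‖⁻¹ • x ∈ Metric.sphere (0 : 𝔼) 1 := by
    rw [mem_sphere_zero_iff_norm, norm_smul, norm_inv, norm_norm, inv_mul_cancel₀ hxn.ne']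
  exact ⟨hmin hmem, hmax hmem⟩

/-- A deviation from c at x would, by homogeneity, occur on the ray of x inside K, and by continuity
on a set of positive measure there. -/
lemma det_hessian_eq_const_of_ae (hK : IsC2Body K) {c : ℝ}
    (hc : ∀ᵐ x ∂(volume.restrict K), (hessian (gaugeEnergy K) x).det = c) {x : 𝔼} (hx : x ≠ 0) :
    (hessian (gaugeEnergy K) x).det = c := by
  by_contra hne
  have hg := hK.gauge_pos hx
  have ht : 0 < (2 * gauge K x)⁻¹ := by positivity
  set z := (2 * gauge K x)⁻¹ • x with hz
  have hz0 : z ≠ 0 := smul_ne_zero ht.ne' hx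
  have hzK : z ∈ interior K := by
    rw [← gauge_lt_one_iff_mem_interior hK.convex hK.mem_nhds_zero, hz,
      IsBodyAroundZero.gauge_pos_smul ht.le]
    field_simp
    norm_num
  have hzne : (hessian (gaugeEnergy K) z).det ≠ c := by rwa [hK.det_hessian_pos_smul ht hx]
  have hev : ∀ᶠ y in 𝓝 z, (hessian (gaugeEnergy K) y).det ≠ c ∧ y ∈ K := by
    refine Filter.Eventually.and ?_ (mem_interior_iff_mem_nhds.1 hzK)
    exact (hK.continuousOn_det_hessian.continuousAt (isOpen_ne.mem_nhds hz0)).eventually_ne hzne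
  have hnull : volume {y | ¬ (y ∈ K → (hessian (gaugeEnergy K) y).det = c)} = 0 :=
    ae_iff.1 ((ae_restrict_iff' hK.isCompact.isClosed.measurableSet).1 hc)
  have hpos := Measure.measure_pos_of_mem_nhds (volume : Measure 𝔼) hev
  refine hpos.ne' (measure_mono_null (fun y hy => ?_) hnull)
  exact fun h => hy.1 (h hy.2)

end Integrals

/-! ### Orthonormal frames and the arithmetic-geometric mean inequality -/

section Frame

variable {E : Type*} [NormedAddCommGroup E] [InnerProductSpace ℝ E] [FiniteDimensional ℝ E]

lemma card_le_sum_of_prod_eq_one {ι : Type*} (s : Finset ι) {a : ι → ℝ} (ha : ∀ i ∈ s, 0 ≤ a i)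
    (h1 : ∏ i ∈ s, a i = 1) : (s.card : ℝ) ≤ ∑ i ∈ s, a i := by
  have hpos : ∀ i ∈ s, 0 < a i := fun i hi => (ha i hi).lt_of_ne' fun h0 => by
    rw [Finset.prod_eq_zero hi h0] at h1
    exact zero_ne_one h1
  have hlog : ∑ i ∈ s, Real.log (a i) = 0 := by
    rw [← Real.log_prod (fun i hi => (hpos i hi).ne'), h1, Real.log_one]
  calc (s.card : ℝ) = ∑ i ∈ s, (1 + Real.log (a i)) := by
        rw [Finset.sum_add_distrib, hlog]; simp
    -- The tangent line bound 1 + log a ≤ a replaces the arithmetic-geometric mean inequality.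
    _ ≤ ∑ i ∈ s, a i := Finset.sum_le_sum fun i hi => by
        have := Real.log_le_sub_one_of_pos (hpos i hi)
        linarith

/-- The trace of a positive semidefinite symmetric endomorphism of determinant one is at least the
dimension. -/
lemma finrank_le_trace_of_det_eq_one {M : E →ₗ[ℝ] E} (hM : M.IsSymmetric)
    (hnn : ∀ v, 0 ≤ ⟪M v, v⟫) (hdet : LinearMap.det M = 1) :
    (Module.finrank ℝ E : ℝ) ≤ LinearMap.trace ℝ E M := by
  have h1 := hM.det_eq_prod_eigenvalues rfl
  have h2 := hM.trace_eq_sum_eigenvalues rfl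
  rw [h2]
  have h3 := card_le_sum_of_prod_eq_one Finset.univ (a := hM.eigenvalues rfl) (fun i _ => ?_) ?_
  · simpa using h3
  · have h4 := hnn (hM.eigenvectorBasis rfl i)
    rw [hM.apply_eigenvectorBasis rfl i] at h4
    simpa [real_inner_smul_left] using h4
  · rw [hdet] at h1
    simpa using h1.symm

/-- An orthonormal frame for the inner product given by a positive definite symmetric endomorphism,
and the arithmetic-geometric mean inequality for traces in this frame. -/
lemma exists_frame {A : E →ₗ[ℝ] E} (hA : A.IsSymmetric) (hpos : ∀ v, v ≠ 0 → 0 < ⟪A v, v⟫) :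
    ∃ u : Fin (Module.finrank ℝ E) → E,
      (∀ i j, ⟪A (u i), u j⟫ = if i = j then 1 else 0) ∧
      (∀ B : E →ₗ[ℝ] E, B.IsSymmetric → (∀ v, 0 ≤ ⟪B v, v⟫) →
        LinearMap.det B = LinearMap.det A →
        (Module.finrank ℝ E : ℝ) ≤ ∑ i, ⟪B (u i), u i⟫) ∧
      (∀ Λ : ℝ, (∀ v, ⟪A v, v⟫ ≤ Λ * ‖v‖ ^ 2) → ∀ z, ‖z‖ ^ 2 ≤ Λ * ∑ i, ⟪z, u i⟫ ^ 2) := by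
  set b := hA.eigenvectorBasis rfl with hb
  set l := hA.eigenvalues rfl with hl
  have hAb : ∀ i, A (b i) = l i • b i := fun i => by
    exact hA.apply_eigenvectorBasis rfl i
  have hlA : ∀ i, ⟪A (b i), b i⟫ = l i := fun i => by
    rw [hAb, real_inner_smul_left, real_inner_self_eq_norm_sq, b.norm_eq_one]; simp
  have hlpos : ∀ i, 0 < l i := fun i => by
    rw [← hlA]
    exact hpos _ (b.orthonormal.ne_zero i)
  -- The frame consists of the eigenvectors of A divided by the square roots of the eigenvalues.
  set c : Fin (Module.finrank ℝ E) → ℝ := fun i => (Real.sqrt (l i))⁻¹ with hc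
  have hc2 : ∀ i, c i * c i * l i = 1 := fun i => by
    have h1 := Real.mul_self_sqrt (hlpos i).le
    have h2 := Real.sqrt_pos.2 (hlpos i)
    simp only [hc]
    rw [← mul_inv, h1, inv_mul_cancel₀ (hlpos i).ne']
  refine ⟨fun i => c i • b i, fun i j => ?_, fun B hB hBnn hBdet => ?_, fun Λ hΛ z => ?_⟩
  · rw [map_smul, hAb, real_inner_smul_left, real_inner_smul_left, real_inner_smul_right,
      b.inner_eq_ite]
    split_ifs with hij
    · rw [← hij]; linear_combination hc2 i
    · ring
  -- R is the inverse square root of A. Then R B R has determinant one, and its trace is the sum of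
  -- the values of B on the frame.
  · set R : E →ₗ[ℝ] E := b.toBasis.constr ℝ fun i => c i • b i with hR
    have hRb : ∀ i, R (b i) = c i • b i := fun i => by
      rw [← b.coe_toBasis, hR, Module.Basis.constr_basis]
      simp
    have hRexp : ∀ x y, ⟪R x, y⟫ = ∑ i, c i * (⟪x, b i⟫ * ⟪b i, y⟫) := fun x y => by
      conv_lhs => rw [← b.sum_repr' x, map_sum, sum_inner]
      refine Finset.sum_congr rfl fun i _ => ?_
      rw [map_smul, hRb, real_inner_smul_left, real_inner_smul_left, real_inner_comm x (b i)]
      ring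
    have hRsymm : R.IsSymmetric := fun x y => by
      rw [hRexp, real_inner_comm, hRexp]
      refine Finset.sum_congr rfl fun i _ => ?_
      rw [real_inner_comm x, real_inner_comm (b i) y]
      ring
    have hRRA : R ∘ₗ R ∘ₗ A = LinearMap.id := by
      refine b.toBasis.ext fun i => ?_
      rw [b.coe_toBasis, LinearMap.comp_apply, LinearMap.comp_apply, hAb, map_smul, map_smul, hRb,
        map_smul, hRb, smul_smul, smul_smul, LinearMap.id_apply]
      rw [show l i * c i * c i = 1 by rw [← hc2 i]; ring, one_smul]
    have hdet : LinearMap.det (R ∘ₗ B ∘ₗ R) = 1 := by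
      have := congrArg LinearMap.det hRRA
      rw [LinearMap.det_comp, LinearMap.det_comp, LinearMap.det_id] at this
      rw [LinearMap.det_comp, LinearMap.det_comp, hBdet, ← this]
      ring
    have hsymm : (R ∘ₗ B ∘ₗ R).IsSymmetric := fun x y => by
      simp only [LinearMap.comp_apply]
      rw [hRsymm, hB, hRsymm]
    have hnn : ∀ v, 0 ≤ ⟪(R ∘ₗ B ∘ₗ R) v, v⟫ := fun v => by
      simp only [LinearMap.comp_apply]
      rw [hRsymm]
      exact hBnn _
    refine (finrank_le_trace_of_det_eq_one hsymm hnn hdet).trans_eq ?_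
    rw [LinearMap.trace_eq_sum_inner _ b]
    refine Finset.sum_congr rfl fun i _ => ?_
    simp only [LinearMap.comp_apply]
    rw [← hRsymm, hRb, real_inner_comm]
  · have h1 : ‖z‖ ^ 2 = ∑ i, ⟪z, b i⟫ ^ 2 := by
      rw [← b.sum_sq_norm_inner_left z]
      simp
    rw [h1, Finset.mul_sum]
    refine Finset.sum_le_sum fun i _ => ?_
    have h2 : l i ≤ Λ := by
      have := hΛ (b i)
      rwa [hlA, b.norm_eq_one, one_pow, mul_one] at this
    rw [real_inner_smul_right, mul_pow]
    have h3 : 1 ≤ Λ * c i ^ 2 := by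
      rw [← hc2 i, mul_comm, ← sq]
      exact mul_le_mul_of_nonneg_right h2 (sq_nonneg _)
    have h4 := mul_le_mul_of_nonneg_right h3 (sq_nonneg ⟪z, b i⟫)
    linarith

end Frame

/-! ### Second order conditions and second differences -/

section HessianCalculus

variable {E : Type*} [NormedAddCommGroup E] [InnerProductSpace ℝ E] [CompleteSpace E]

/-- The second order necessary condition at a local maximum. -/
lemma inner_nonpos_of_isLocalMax {F : E → ℝ} {G : E → E} {H : E →L[ℝ] E} {x : E}
    (hG : ∀ᶠ y in 𝓝 x, HasGradientAt F (G y) y) (hH : HasFDerivAt G H x) (hmax : IsLocalMax F x)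
    (u : E) : ⟪H u, u⟫ ≤ 0 := by
  by_contra! hpos
  have hline : ∀ t : ℝ, HasDerivAt (fun t : ℝ => x + t • u) u t := fun t => by
    simpa using ((hasDerivAt_id t).smul_const u).const_add x
  have hl0 : Filter.Tendsto (fun t : ℝ => x + t • u) (𝓝 0) (𝓝 x) := by
    simpa using (hline 0).continuousAt.tendsto
  set f : ℝ → ℝ := fun t => F (x + t • u) with hf
  have hder : ∀ᶠ t : ℝ in 𝓝 0, HasDerivAt f ⟪G (x + t • u), u⟫ t := by
    filter_upwards [hl0.eventually hG] with t ht
    exact ht.hasFDerivAt.comp_hasDerivAt t (hline t)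
  have hder' : deriv f =ᶠ[𝓝 0] fun t => ⟪G (x + t • u), u⟫ := hder.mono fun t ht => ht.deriv
  have hsec : HasDerivAt (fun t : ℝ => ⟪G (x + t • u), u⟫) ⟪H u, u⟫ 0 := by
    have h2 : HasFDerivAt G H (x + (0 : ℝ) • u) := by simpa using hH
    have := (h2.comp_hasDerivAt (0 : ℝ) (hline 0)).inner ℝ (hasDerivAt_const (0 : ℝ) u)
    simpa using this
  have hdd : deriv (deriv f) 0 = ⟪H u, u⟫ := by
    rw [hder'.deriv_eq, hsec.deriv]
  have hmaxf : IsLocalMax f 0 := by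
    have : ∀ᶠ t : ℝ in 𝓝 0, F (x + t • u) ≤ F x := hl0.eventually hmax
    filter_upwards [this] with t ht
    simpa [hf] using ht
  -- A positive second derivative would make 0 a local minimum as well, so f would be locally
  -- constant and its second derivative zero.
  have hminf : IsLocalMin f 0 := isLocalMin_of_deriv_deriv_pos (by rw [hdd]; exact hpos)
    hmaxf.deriv_eq_zero hder.self_of_nhds.continuousAt
  have hconst : f =ᶠ[𝓝 0] fun _ => f 0 := by
    filter_upwards [hmaxf, hminf] with t h1 h2 using le_antisymm h1 h2
  have h0 : deriv f =ᶠ[𝓝 0] fun _ => 0 := by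
    filter_upwards [hconst.eventually_nhds] with t ht
    have ht' : f =ᶠ[𝓝 t] fun _ => f 0 := ht
    rw [ht'.deriv_eq, deriv_const]
  rw [h0.deriv_eq, deriv_const] at hdd
  exact hpos.ne hdd

/-- The mean value form of the second difference. -/
lemma exists_second_difference_eq {φ : E → ℝ} {x e : E} {t : ℝ} (ht : 0 < t)
    (hφ : ∀ s ∈ Set.Icc (-t) t, ContDiffAt ℝ 2 φ (x + s • e)) :
    ∃ s ∈ Set.Ioo 0 t, φ (x + t • e) + φ (x - t • e) - 2 * φ x =
      t ^ 2 * ((⟪hessian φ (x + s • e) e, e⟫ + ⟪hessian φ (x - s • e) e, e⟫) / 2) := by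
  have hline : ∀ t : ℝ, HasDerivAt (fun t : ℝ => x + t • e) e t := fun t => by
    simpa using ((hasDerivAt_id t).smul_const e).const_add x
  have hline' : ∀ t : ℝ, HasDerivAt (fun t : ℝ => x - t • e) (-e) t := fun t => by
    simpa using ((hasDerivAt_id t).smul_const e).const_sub x
  have hφ1 : ∀ s ∈ Set.Icc 0 t, ContDiffAt ℝ 2 φ (x + s • e) := fun s hs =>
    hφ s ⟨by linarith [hs.1], hs.2⟩
  have hφ2 : ∀ s ∈ Set.Icc 0 t, ContDiffAt ℝ 2 φ (x - s • e) := fun s hs => by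
    have := hφ (-s) ⟨by linarith [hs.2], by linarith [hs.1]⟩
    rwa [neg_smul, ← sub_eq_add_neg] at this
  set h : ℝ → ℝ := fun s => φ (x + s • e) + φ (x - s • e) with hh
  set h' : ℝ → ℝ := fun s => ⟪∇ φ (x + s • e), e⟫ - ⟪∇ φ (x - s • e), e⟫ with hh'
  have d1 : ∀ s ∈ Set.Icc 0 t, HasDerivAt h (h' s) s := fun s hs => by
    have a1 := ((hφ1 s hs).differentiableAt (by norm_num)).hasGradientAt.hasFDerivAt.comp_hasDerivAt
      s (hline s)
    have a2 := ((hφ2 s hs).differentiableAt (by norm_num)).hasGradientAt.hasFDerivAt.comp_hasDerivAt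
      s (hline' s)
    refine (a1.add a2).congr_deriv ?_
    simp [hh', sub_eq_add_neg]
  have d2 : ∀ s ∈ Set.Icc 0 t, HasDerivAt h'
      (⟪hessian φ (x + s • e) e, e⟫ + ⟪hessian φ (x - s • e) e, e⟫) s := fun s hs => by
    have a1 := ((hasFDerivAt_gradient (hφ1 s hs)).comp_hasDerivAt s (hline s)).inner ℝ
      (hasDerivAt_const s e)
    have a2 := ((hasFDerivAt_gradient (hφ2 s hs)).comp_hasDerivAt s (hline' s)).inner ℝ
      (hasDerivAt_const s e)
    refine (a1.sub a2).congr_deriv ?_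
    simp
  -- Cauchy's mean value theorem against s² reduces to h'(r)/(2r). As h' vanishes at 0, a second
  -- mean value step turns this into half a second derivative.
  obtain ⟨r, hr, hr'⟩ := exists_ratio_hasDerivAt_eq_ratio_slope h h' ht
    (fun s hs => (d1 s hs).continuousAt.continuousWithinAt)
    (fun s hs => d1 s (Set.Ioo_subset_Icc_self hs)) (fun s => s ^ 2) (fun s => 2 * s)
    (by fun_prop) (fun s _ => by simpa using hasDerivAt_pow 2 s)
  have hrt : Set.Icc 0 r ⊆ Set.Icc 0 t := Set.Icc_subset_Icc_right hr.2.le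
  obtain ⟨s, hs, hs'⟩ := exists_hasDerivAt_eq_slope h' _ hr.1
    (fun s hs => (d2 s (hrt hs)).continuousAt.continuousWithinAt)
    (fun s hs => d2 s (hrt (Set.Ioo_subset_Icc_self hs)))
  refine ⟨s, ⟨hs.1, hs.2.trans hr.2⟩, ?_⟩
  have h0 : h' 0 = 0 := by simp [hh']
  have hr0 : 0 < r := hr.1
  rw [h0, sub_zero, sub_zero, eq_div_iff hr0.ne'] at hs'
  have hh0 : h 0 = 2 * φ x := by simp [hh]; ring
  have hht : h t = φ (x + t • e) + φ (x - t • e) := rfl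
  rw [← hs', hh0, hht] at hr'
  have : r * (2 * (φ (x + t • e) + φ (x - t • e) - 2 * φ x)) =
      r * (t ^ 2 * (⟪hessian φ (x + s • e) e, e⟫ + ⟪hessian φ (x - s • e) e, e⟫)) := by
    linear_combination -hr'
  have := mul_left_cancel₀ hr0.ne' this
  linarith

end HessianCalculus

/-! ### A Hopf barrier argument for the Monge–Ampère equation -/

section StrongMaximum

variable {E : Type*} [NormedAddCommGroup E] [InnerProductSpace ℝ E]

lemma hasGradientAt_exp_neg_norm_sq [CompleteSpace E] (a : ℝ) (y x : E) :
    HasGradientAt (fun x => Real.exp (-a * ‖x - y‖ ^ 2))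
      ((-2 * a * Real.exp (-a * ‖x - y‖ ^ 2)) • (x - y)) x := by
  rw [hasGradientAt_iff_hasFDerivAt]
  have h1 : HasFDerivAt (fun x : E => x - y) (ContinuousLinearMap.id ℝ E) x :=
    (hasFDerivAt_id x).sub_const y
  refine ((h1.norm_sq.const_mul (-a)).exp).congr_fderiv ?_
  ext v
  simp
  ring

lemma hasFDerivAt_gradient_exp_neg_norm_sq [CompleteSpace E] (a : ℝ) (y x : E) :
    HasFDerivAt (fun x => (-2 * a * Real.exp (-a * ‖x - y‖ ^ 2)) • (x - y))
      ((-2 * a * Real.exp (-a * ‖x - y‖ ^ 2)) • ContinuousLinearMap.id ℝ E +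
        (4 * a ^ 2 * Real.exp (-a * ‖x - y‖ ^ 2)) •
          (innerSL ℝ (x - y)).smulRight (x - y)) x := by
  have h1 : HasFDerivAt (fun x : E => x - y) (ContinuousLinearMap.id ℝ E) x :=
    (hasFDerivAt_id x).sub_const y
  refine ((((h1.norm_sq.const_mul (-a)).exp).const_mul (-2 * a)).smul h1).congr_fderiv ?_
  ext v
  simp [smul_smul]
  congr 1
  ring

variable [FiniteDimensional ℝ E] {φ : E → ℝ} {U : Set E}

/-- Uniform ellipticity on compact sets. -/
lemma exists_ellipticity_bounds [Nontrivial E] (hφ : ∀ x ∈ U, ContDiffAt ℝ 2 φ x)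
    (hpos : ∀ x ∈ U, ∀ v, v ≠ 0 → 0 < ⟪hessian φ x v, v⟫) {C : Set E} (hC : IsCompact C)
    (hCU : C ⊆ U) : ∃ l L : ℝ, 0 < l ∧ 0 < L ∧
      ∀ x ∈ C, ∀ v, l * ‖v‖ ^ 2 ≤ ⟪hessian φ x v, v⟫ ∧ ⟪hessian φ x v, v⟫ ≤ L * ‖v‖ ^ 2 := by
  set q : E × E → ℝ := fun p => ⟪hessian φ p.1 p.2, p.2⟫ with hq
  have hcont : ContinuousOn q (C ×ˢ Metric.sphere 0 1) := by
    have h1 : ContinuousOn (fun p : E × E => hessian φ p.1) (C ×ˢ Metric.sphere 0 1) :=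
      fun p hp => ContinuousAt.continuousWithinAt
        ((continuousAt_hessian (hφ _ (hCU hp.1))).comp continuousAt_fst)
    exact (h1.clm_apply continuousOn_snd).inner continuousOn_snd
  have hcomp := hC.prod (isCompact_sphere (0 : E) 1)
  have hqpos : ∀ p ∈ C ×ˢ Metric.sphere (0 : E) 1, 0 < q p := fun p hp =>
    hpos _ (hCU hp.1) _ (by rintro h; simpa [h] using hp.2)
  obtain ⟨l, hl, hl'⟩ := hcomp.exists_forall_le' hcont hqpos
  obtain ⟨L, hL⟩ := (hcomp.image_of_continuousOn hcont).bddAbove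
  refine ⟨l, max L 1, hl, by positivity, fun x hx v => ?_⟩
  rcases eq_or_ne v 0 with rfl | hv
  · simp
  have hvn : 0 < ‖v‖ := norm_pos_iff.2 hv
  have hmem : (x, ‖v‖⁻¹ • v) ∈ C ×ˢ Metric.sphere (0 : E) 1 := by
    refine ⟨hx, ?_⟩
    rw [mem_sphere_zero_iff_norm, norm_smul, norm_inv, norm_norm, inv_mul_cancel₀ hvn.ne']
  have h1 : ⟪hessian φ x v, v⟫ = q (x, ‖v‖⁻¹ • v) * ‖v‖ ^ 2 := by
    simp only [hq, map_smul, real_inner_smul_left, real_inner_smul_right]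
    field_simp
  rw [h1]
  refine ⟨mul_le_mul_of_nonneg_right (hl' _ hmem) (sq_nonneg _),
    mul_le_mul_of_nonneg_right ((hL ⟨_, hmem, rfl⟩).trans (le_max_left _ _)) (sq_nonneg _)⟩

/-- A pure second derivative of a solution of the Monge–Ampère equation with constant right-hand
side cannot touch its upper bound at a boundary point of a ball in which it is smaller. -/
lemma not_touching_second_derivative [Nontrivial E] (hU : IsOpen U)
    (hφ : ∀ x ∈ U, ContDiffAt ℝ 2 φ x)
    (hpos : ∀ x ∈ U, ∀ v, v ≠ 0 → 0 < ⟪hessian φ x v, v⟫) {c : ℝ}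
    (hdet : ∀ x ∈ U, (hessian φ x).det = c) {e : E} {M : ℝ}
    (hM : ∀ x ∈ U, ⟪hessian φ x e, e⟫ ≤ M) {y z : E} {r : ℝ} (hr : 0 < r) (hz : z ∈ U)
    (hyz : dist z y = r) (hball : ∀ x ∈ U, dist x y ≤ r → x ≠ z → ⟪hessian φ x e, e⟫ < M) :
    ⟪hessian φ z e, e⟫ ≠ M := by
  intro hzM
  set w : E → ℝ := fun x => ⟪hessian φ x e, e⟫ with hw
  have hwcont : ContinuousOn w U := fun x hx => ContinuousAt.continuousWithinAt
    (((continuousAt_hessian (hφ x hx)).clm_apply continuousAt_const).inner continuousAt_const)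
  -- The bound r/2 keeps the small ball away from y, where the barrier fails to be a subsolution;
  -- the radius 2ρ leaves room for the shifts by ± t • e.
  obtain ⟨ρ, hρ, hρr, hρU⟩ : ∃ ρ > 0, ρ ≤ r / 2 ∧ Metric.closedBall z (2 * ρ) ⊆ U := by
    obtain ⟨d, hd, hdU⟩ := Metric.nhds_basis_closedBall.mem_iff.1 (hU.mem_nhds hz)
    refine ⟨min (d / 2) (r / 2), by positivity, min_le_right _ _, ?_⟩
    refine (Metric.closedBall_subset_closedBall ?_).trans hdU
    have := min_le_left (d / 2) (r / 2)
    linarith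
  obtain ⟨l, L, hl, hL, hell⟩ :=
    exists_ellipticity_bounds hφ hpos (isCompact_closedBall z (2 * ρ)) hρU
  have hsub : Metric.closedBall z ρ ⊆ Metric.closedBall z (2 * ρ) :=
    Metric.closedBall_subset_closedBall (by linarith)
  have hsphU : Metric.sphere z ρ ⊆ U := (Metric.sphere_subset_closedBall.trans hsub).trans hρU
  set N : ℝ := (Module.finrank ℝ E : ℝ) with hN
  -- At an interior maximum the estimates below force a ≤ 2NL/(l r²); adding 1 contradicts this.
  set a : ℝ := 2 * N * L / (l * r ^ 2) + 1 with ha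
  have hapos : 0 < a := by positivity
  set b : E → ℝ := fun x => Real.exp (-a * ‖x - y‖ ^ 2) with hb
  set m : ℝ := Real.exp (-a * r ^ 2) with hm
  have hbcont : Continuous b := by fun_prop
  have hbz : b z = m := by simp only [hb, hm]; rw [← dist_eq_norm, hyz]
  have hble : ∀ x, b x ≤ 1 := fun x => Real.exp_le_one_iff.2 (by
    have := mul_nonneg hapos.le (sq_nonneg ‖x - y‖)
    linarith)
  have hbout : ∀ x, r < dist x y → b x < m := fun x hx => by
    refine Real.exp_lt_exp.2 ?_
    rw [dist_eq_norm] at hx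
    have h1 : r ^ 2 < ‖x - y‖ ^ 2 := pow_lt_pow_left₀ hx hr.le (by norm_num)
    nlinarith
  have hm0 : 0 < m := Real.exp_pos _
  -- the barrier makes the boundary values strictly smaller
  obtain ⟨ε, hε, hεS⟩ : ∃ ε > 0, ∀ x ∈ Metric.sphere z ρ, 0 < M + ε * m - (w x + ε * b x) := by
    have hT : IsCompact (Metric.sphere z ρ ∩ Metric.closedBall y r) :=
      (isCompact_sphere z ρ).inter_right Metric.isClosed_closedBall
    obtain ⟨δ, hδ, hδ'⟩ := hT.exists_forall_le' (f := fun x => M - w x) (a := 0)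
      (continuousOn_const.sub (hwcont.mono fun x hx => hsphU hx.1)) (fun x hx => by
        have hxz : x ≠ z := by
          rintro rfl
          have := hx.1
          simp at this
          exact hρ.ne this
        have := hball x (hsphU hx.1) hx.2 hxz
        linarith)
    refine ⟨δ / 2, by positivity, fun x hx => ?_⟩
    by_cases hxr : dist x y ≤ r
    · have h1 := hδ' x ⟨hx, hxr⟩
      have h2 := hble x
      have h3 : δ / 2 * b x ≤ δ / 2 * 1 := by gcongr
      have h4 : 0 < δ / 2 * m := by positivity
      linarith
    · have h1 := hM x (hsphU hx)
      have h2 : δ / 2 * b x < δ / 2 * m := by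
        have := hbout x (not_le.1 hxr)
        gcongr
      change 0 < M + δ / 2 * m - (w x + δ / 2 * b x)
      have h3 : w x ≤ M := h1
      linarith
  obtain ⟨γ, hγ, hγS⟩ := (isCompact_sphere z ρ).exists_forall_le'
    (f := fun x => M + ε * m - (w x + ε * b x)) (a := 0)
    (continuousOn_const.sub ((hwcont.mono hsphU).add
      (hbcont.continuousOn.const_smul ε))) hεS
  -- The tolerance γ/3 lets the scaled second difference err both on the sphere and at z, and still
  -- leaves a gap of γ/3.
  obtain ⟨δ, hδ, hδw⟩ := Metric.uniformContinuousOn_iff.1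
    ((isCompact_closedBall z (2 * ρ)).uniformContinuousOn_of_continuous (hwcont.mono hρU))
    (γ / 3) (by positivity)
  obtain ⟨t, ht, htδ, htρ⟩ : ∃ t > 0, t * ‖e‖ < δ ∧ t * ‖e‖ ≤ ρ := by
    have hlim : Filter.Tendsto (fun t : ℝ => t * ‖e‖) (𝓝[>] 0) (𝓝 0) := by
      have : Filter.Tendsto (fun t : ℝ => t * ‖e‖) (𝓝 0) (𝓝 (0 * ‖e‖)) :=
        (continuous_id.mul continuous_const).tendsto _
      rw [zero_mul] at this
      exact this.mono_left nhdsWithin_le_nhds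
    obtain ⟨t, h1, h2, h3⟩ := ((hlim.eventually (gt_mem_nhds hδ)).and
      ((hlim.eventually (gt_mem_nhds hρ)).and self_mem_nhdsWithin)).exists
    exact ⟨t, h3, h1, h2.le⟩
  have hshift : ∀ x ∈ Metric.closedBall z ρ, ∀ s ∈ Set.Icc (-t) t,
      x + s • e ∈ Metric.closedBall z (2 * ρ) ∧ dist (x + s • e) x < δ := by
    intro x hx s hs
    have h1 : ‖s • e‖ ≤ t * ‖e‖ := by
      rw [norm_smul]
      gcongr
      exact abs_le.2 hs
    have h2 : dist (x + s • e) x = ‖s • e‖ := by rw [dist_eq_norm]; congr 1; abel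
    refine ⟨?_, by rw [h2]; linarith⟩
    have h3 := dist_triangle (x + s • e) x z
    rw [Metric.mem_closedBall] at hx ⊢
    linarith
  have hshift1 : ∀ x ∈ Metric.closedBall z ρ, x + t • e ∈ U := fun x hx =>
    hρU (hshift x hx t ⟨by linarith, le_rfl⟩).1
  have hshift2 : ∀ x ∈ Metric.closedBall z ρ, x - t • e ∈ U := fun x hx => by
    have := hρU (hshift x hx (-t) ⟨le_rfl, by linarith⟩).1
    rwa [neg_smul, ← sub_eq_add_neg] at this
  -- As φ is only C², w cannot be differentiated. The second difference Q is C² and approximates t²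
  -- w uniformly.
  set Q : E → ℝ := fun x => φ (x + t • e) + φ (x - t • e) - 2 * φ x with hQ
  have hQw : ∀ x ∈ Metric.closedBall z ρ, |Q x - t ^ 2 * w x| ≤ t ^ 2 * (γ / 3) := by
    intro x hx
    obtain ⟨s, hs, hs'⟩ := exists_second_difference_eq (φ := φ) (x := x) (e := e) ht
      (fun s hs => hφ _ (hρU (hshift x hx s hs).1))
    have hs1 : s ∈ Set.Icc (-t) t := ⟨by linarith [hs.1], hs.2.le⟩
    have hs2 : -s ∈ Set.Icc (-t) t := ⟨by linarith [hs.2], by linarith [hs.1]⟩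
    have h1 := hδw _ (hshift x hx s hs1).1 _ (hsub hx) (hshift x hx s hs1).2
    have h2 := hδw _ (hshift x hx (-s) hs2).1 _ (hsub hx) (hshift x hx (-s) hs2).2
    rw [neg_smul, ← sub_eq_add_neg, Real.dist_eq] at h2
    rw [Real.dist_eq] at h1
    have h3 : Q x = t ^ 2 * ((w (x + s • e) + w (x - s • e)) / 2) := hs'
    rw [h3, ← mul_sub, abs_mul, abs_of_nonneg (sq_nonneg t)]
    refine mul_le_mul_of_nonneg_left ?_ (sq_nonneg t)
    rw [abs_lt] at h1 h2
    rw [abs_le]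
    constructor <;> linarith
  set F : E → ℝ := fun x => Q x + ε * t ^ 2 * b x with hF
  have ht2 : 0 < t ^ 2 := by positivity
  have hFcont : ContinuousOn F (Metric.closedBall z ρ) := by
    have hc : ∀ x ∈ U, ContinuousAt φ x := fun x hx => (hφ x hx).continuousAt
    intro x hx
    refine ContinuousAt.continuousWithinAt ?_
    have c1 : ContinuousAt (fun x => φ (x + t • e)) x :=
      ContinuousAt.comp (f := fun x => x + t • e) (hc _ (hshift1 x hx)) (by fun_prop)
    have c2 : ContinuousAt (fun x => φ (x - t • e)) x :=
      ContinuousAt.comp (f := fun x => x - t • e) (hc _ (hshift2 x hx)) (by fun_prop)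
    exact ((c1.add c2).sub (continuousAt_const.mul (hc _ (hρU (hsub hx))))).add
      (continuousAt_const.mul hbcont.continuousAt)
  have hzmem : z ∈ Metric.closedBall z ρ := Metric.mem_closedBall_self hρ.le
  obtain ⟨x, hx, hxmax⟩ := (isCompact_closedBall z ρ).exists_isMaxOn ⟨z, hzmem⟩ hFcont
  -- On the sphere F is at most t²(M + εm - 2γ/3), and at z it is at least t²(M + εm - γ/3).
  have hxball : x ∈ Metric.ball z ρ := by
    rw [Metric.mem_closedBall] at hx
    refine lt_of_le_of_ne hx fun hxs => ?_
    have h1 := hγS x hxs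
    have h2 := (abs_le.1 (hQw x hx)).2
    have h3 := (abs_le.1 (hQw z hzmem)).1
    have h4 : F z ≤ F x := hxmax hzmem
    simp only [hF, hbz] at h4
    have h5 : w z = M := hzM
    rw [h5] at h3
    have h6 := mul_le_mul_of_nonneg_left h1 ht2.le
    have h7 : 0 < t ^ 2 * γ := by positivity
    nlinarith
  have hxU : x ∈ U := hρU (hsub hx)
  have hlocmax : IsLocalMax F x := by
    filter_upwards [Metric.isOpen_ball.mem_nhds hxball] with x' hx'
    exact hxmax (Metric.ball_subset_closedBall hx')
  have hgrad : ∀ᶠ x' in 𝓝 x, HasGradientAt F (∇ φ (x' + t • e) + ∇ φ (x' - t • e) -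
      (2 : ℝ) • ∇ φ x' + (ε * t ^ 2) • ((-2 * a * Real.exp (-a * ‖x' - y‖ ^ 2)) • (x' - y))) x' := by
    filter_upwards [Metric.isOpen_ball.mem_nhds hxball] with x' hx'
    have hx'' := Metric.ball_subset_closedBall hx'
    have hg : ∀ p ∈ U, HasFDerivAt φ (InnerProductSpace.toDual ℝ E (∇ φ p)) p := fun p hp =>
      ((hφ p hp).differentiableAt (by norm_num)).hasGradientAt.hasFDerivAt
    have g1 := (hg _ (hshift1 x' hx'')).comp x' ((hasFDerivAt_id x').add_const (t • e))
    have g2 := (hg _ (hshift2 x' hx'')).comp x' ((hasFDerivAt_id x').sub_const (t • e))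
    have g3 := (hg _ (hρU (hsub hx''))).const_mul (2 : ℝ)
    have g4 := (hasGradientAt_exp_neg_norm_sq a y x').hasFDerivAt.const_mul (ε * t ^ 2)
    rw [hasGradientAt_iff_hasFDerivAt]
    refine (((g1.add g2).sub g3).add g4).congr_fderiv ?_
    ext v
    simp
  have hder : HasFDerivAt (fun x' => ∇ φ (x' + t • e) + ∇ φ (x' - t • e) -
      (2 : ℝ) • ∇ φ x' + (ε * t ^ 2) • ((-2 * a * Real.exp (-a * ‖x' - y‖ ^ 2)) • (x' - y)))
      (hessian φ (x + t • e) + hessian φ (x - t • e) - (2 : ℝ) • hessian φ x + (ε * t ^ 2) •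
        ((-2 * a * Real.exp (-a * ‖x - y‖ ^ 2)) • ContinuousLinearMap.id ℝ E +
        (4 * a ^ 2 * Real.exp (-a * ‖x - y‖ ^ 2)) •
          (innerSL ℝ (x - y)).smulRight (x - y))) x := by
    have g1 := (hasFDerivAt_gradient (hφ _ (hshift1 x hx))).comp x
      ((hasFDerivAt_id x).add_const (t • e))
    have g2 := (hasFDerivAt_gradient (hφ _ (hshift2 x hx))).comp x
      ((hasFDerivAt_id x).sub_const (t • e))
    have g3 := (hasFDerivAt_gradient (hφ _ hxU)).const_smul (2 : ℝ)
    have g4 := (hasFDerivAt_gradient_exp_neg_norm_sq a y x).const_smul (ε * t ^ 2)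
    exact ((g1.add g2).sub g3).add g4
  have hneg := inner_nonpos_of_isLocalMax hgrad hder hlocmax
  have hsymm : ∀ p ∈ U, (hessian φ p : E →ₗ[ℝ] E).IsSymmetric := fun p hp v v' =>
    inner_hessian_comm (hφ p hp) v v'
  have hnn : ∀ p ∈ U, ∀ v, 0 ≤ ⟪hessian φ p v, v⟫ := fun p hp v => by
    rcases eq_or_ne v 0 with rfl | hv
    · simp
    · exact (hpos p hp v hv).le
  obtain ⟨u, hu1, huB, huL⟩ := exists_frame (hsymm x hxU) (fun v hv => hpos x hxU v hv)
  have hu1' : ∀ i, ⟪hessian φ x (u i), u i⟫ = 1 := fun i => by simpa using hu1 i i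
  -- The determinants at the shifted points agree with the one at x, so in the frame of the Hessian
  -- at x both traces are at least N. Hence Q contributes nonnegatively to the trace at the maximum.
  have hB1 : N ≤ ∑ i, ⟪hessian φ (x + t • e) (u i), u i⟫ :=
    huB _ (hsymm _ (hshift1 x hx)) (hnn _ (hshift1 x hx))
      ((hdet _ (hshift1 x hx)).trans (hdet x hxU).symm)
  have hB2 : N ≤ ∑ i, ⟪hessian φ (x - t • e) (u i), u i⟫ :=
    huB _ (hsymm _ (hshift2 x hx)) (hnn _ (hshift2 x hx))
      ((hdet _ (hshift2 x hx)).trans (hdet x hxU).symm)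
  set X := Real.exp (-a * ‖x - y‖ ^ 2) with hX
  have hXpos : 0 < X := Real.exp_pos _
  have hsum := Finset.sum_nonpos (s := Finset.univ) fun i _ => hneg (u i)
  have hterm : ∀ i, ⟪(hessian φ (x + t • e) + hessian φ (x - t • e) - (2 : ℝ) • hessian φ x +
      (ε * t ^ 2) • ((-2 * a * X) • ContinuousLinearMap.id ℝ E +
        (4 * a ^ 2 * X) • (innerSL ℝ (x - y)).smulRight (x - y))) (u i), u i⟫ =
      ⟪hessian φ (x + t • e) (u i), u i⟫ + ⟪hessian φ (x - t • e) (u i), u i⟫ - 2 +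
        (ε * t ^ 2 * (2 * a * X)) * (2 * a * ⟪x - y, u i⟫ ^ 2 - ‖u i‖ ^ 2) := fun i => by
    simp only [add_apply, sub_apply,
      smul_apply, ContinuousLinearMap.smulRight_apply,
      ContinuousLinearMap.id_apply, innerSL_apply_apply, inner_add_left, inner_sub_left,
      real_inner_smul_left, hu1', real_inner_self_eq_norm_sq]
    rw [← inner_sub_left]
    ring
  rw [Finset.sum_congr rfl fun i _ => hterm i, Finset.sum_add_distrib, Finset.sum_sub_distrib,
    Finset.sum_add_distrib, ← Finset.mul_sum, Finset.sum_sub_distrib, ← Finset.mul_sum] at hsum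
  have hcard : ∑ _i : Fin (Module.finrank ℝ E), (2 : ℝ) = 2 * N := by
    simp [hN, mul_comm]
  rw [hcard] at hsum
  set S1 := ∑ i, ⟪x - y, u i⟫ ^ 2 with hS1
  set S2 := ∑ i, ‖u i‖ ^ 2 with hS2
  -- Otherwise the barrier term alone makes the trace of the Hessian of F positive, against the
  -- second order condition.
  have hkey : 2 * a * S1 ≤ S2 := by
    by_contra! hlt
    have : 0 < (ε * t ^ 2 * (2 * a * X)) * (2 * a * S1 - S2) :=
      mul_pos (by positivity) (by linarith)
    linarith
  have hS2le : l * S2 ≤ N := by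
    rw [hS2, Finset.mul_sum]
    calc ∑ i, l * ‖u i‖ ^ 2 ≤ ∑ i : Fin (Module.finrank ℝ E), (1 : ℝ) :=
          Finset.sum_le_sum fun i _ => by
            rw [← hu1' i]; exact (hell x (hsub hx) (u i)).1
      _ = N := by simp [hN]
  have hS1ge : ‖x - y‖ ^ 2 ≤ L * S1 :=
    huL L (fun v => (hell x (hsub hx) v).2) (x - y)
  have hnorm : r / 2 ≤ ‖x - y‖ := by
    have h1 := dist_triangle z x y
    rw [hyz, dist_comm z x] at h1
    rw [← dist_eq_norm]
    have := Metric.mem_closedBall.1 hx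
    linarith
  have hnorm2 : (r / 2) ^ 2 ≤ ‖x - y‖ ^ 2 := pow_le_pow_left₀ (by positivity) hnorm 2
  have haval : a * (l * r ^ 2) = 2 * N * L + l * r ^ 2 := by
    rw [ha]; field_simp
  have h1 : l * (2 * a) * (r / 2) ^ 2 ≤ l * (2 * a) * (L * S1) :=
    mul_le_mul_of_nonneg_left (hnorm2.trans hS1ge) (by positivity)
  have h2 : L * (l * (2 * a * S1)) ≤ L * N :=
    mul_le_mul_of_nonneg_left ((mul_le_mul_of_nonneg_left hkey hl.le).trans hS2le) hL.le
  have h3 : 0 < l * r ^ 2 := by positivity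
  nlinarith

end StrongMaximum

/-! ### Strong maximum principle and constancy of the Hessian -/

section Rigidity

variable {E : Type*} [NormedAddCommGroup E] [InnerProductSpace ℝ E]

/-- If the form vanished at v, then along v + s • T v it would have the nonzero linear term 2s‖T
v‖², hence be negative for some small negative s. -/
lemma inner_apply_self_pos [FiniteDimensional ℝ E] {T : E →ₗ[ℝ] E} (hT : T.IsSymmetric) (hnn : ∀ v, 0 ≤ ⟪T v, v⟫)
    (hdet : LinearMap.det T ≠ 0) {v : E} (hv : v ≠ 0) : 0 < ⟪T v, v⟫ := by
  have hinj : Function.Injective T := (LinearMap.equivOfDetNeZero T hdet).injective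
  have hw : T v ≠ 0 := fun h => hv (hinj (by rw [h, map_zero]))
  have hq : 0 < ⟪T v, T v⟫ := real_inner_self_pos.2 hw
  refine (hnn v).lt_of_ne' fun h0 => ?_
  set w := T v with hwdef
  have hk := hnn w
  set k := ⟪T w, w⟫ with hkdef
  set q := ⟪w, w⟫ with hqdef
  have h1 : ∀ s : ℝ, 0 ≤ 2 * s * q + s ^ 2 * k := fun s => by
    have h2 := hnn (v + s • w)
    rw [map_add, map_smul, inner_add_left, inner_add_right, inner_add_right, real_inner_smul_left,
      real_inner_smul_left, real_inner_smul_right, real_inner_smul_right, hT w v, ← hwdef, h0] at h2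
    linarith
  -- The minimizer would be -q/k; the summand 1 covers k = 0.
  have h2 := h1 (-(q / (k + 1)))
  have h3 : 2 * -(q / (k + 1)) * q + (-(q / (k + 1))) ^ 2 * k =
      -(q ^ 2 * (k + 2) / (k + 1) ^ 2) := by
    field_simp; ring
  rw [h3] at h2
  have : 0 < q ^ 2 * (k + 2) / (k + 1) ^ 2 := by positivity
  linarith

/-- A compact set meets, at a point nearest to a given outside point, a closed ball that is
otherwise disjoint from it. -/
lemma exists_touching_ball {C : Set E} (hC : IsCompact C) (hne : C.Nonempty) {p : E} (hp : p ∉ C) :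
    ∃ z ∈ C, ∃ y : E, ∃ r > 0, dist z y = r ∧ (∀ x ∈ C, 2 * r ≤ dist x p) ∧
      ∀ x, dist x y ≤ r → x ≠ z → dist x p < 2 * r ∧ x ∉ C := by
  obtain ⟨z, hz, hzp⟩ := hC.exists_infDist_eq_dist hne p
  have hd : 0 < dist z p := dist_pos.2 fun h => hp (h ▸ hz)
  -- The touching ball has its centre midway between p and z. It lies in the ball about p through z
  -- and meets the bounding sphere only at z, by the parallelogram law.
  have hmid : ∀ x, x - p = (x - midpoint ℝ p z) + (z - midpoint ℝ p z) := fun x => by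
    have : midpoint ℝ p z + midpoint ℝ p z = p + z := midpoint_add_self ℝ p z
    rw [eq_comm, ← sub_eq_zero]
    calc _ = (p + z) - (midpoint ℝ p z + midpoint ℝ p z) := by abel
      _ = 0 := by rw [this, sub_self]
  have hzmid : ‖z - midpoint ℝ p z‖ = dist z p / 2 := by
    rw [← dist_eq_norm, dist_right_midpoint, dist_comm p z]
    simp; ring
  have hmin : ∀ x ∈ C, dist z p ≤ dist x p := fun x hxC => by
    have := Metric.infDist_le_dist_of_mem (x := p) hxC
    rwa [hzp, dist_comm p z, dist_comm p x] at this
  refine ⟨z, hz, midpoint ℝ p z, dist z p / 2, by positivity, by rw [dist_eq_norm, hzmid],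
    fun x hx => by linarith [hmin x hx], fun x hx hxz => ?_⟩
  have hlt : dist x p < dist z p := by
    rw [dist_eq_norm x p, hmid x]
    rw [dist_eq_norm] at hx
    have h1 := parallelogram_law_with_norm ℝ (x - midpoint ℝ p z) (z - midpoint ℝ p z)
    have h2 : x - midpoint ℝ p z - (z - midpoint ℝ p z) = x - z := by abel
    rw [h2, hzmid] at h1
    have h3 : 0 < ‖x - z‖ := norm_pos_iff.2 (sub_ne_zero.2 hxz)
    refine lt_of_pow_lt_pow_left₀ 2 hd.le ?_
    nlinarith [norm_nonneg (x - midpoint ℝ p z)]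
  exact ⟨by linarith, fun hxC => by linarith [hmin x hxC]⟩

variable [FiniteDimensional ℝ E] {φ : E → ℝ}

/-- The strong maximum principle for pure second derivatives of solutions of the Monge–Ampère
equation with constant right-hand side. -/
lemma second_derivative_eq_of_isMax [Nontrivial E] {U : Set E} (hU : IsOpen U)
    (hUc : IsPreconnected U) (hφ : ∀ x ∈ U, ContDiffAt ℝ 2 φ x)
    (hpos : ∀ x ∈ U, ∀ v, v ≠ 0 → 0 < ⟪hessian φ x v, v⟫) {c : ℝ}
    (hdet : ∀ x ∈ U, (hessian φ x).det = c) {e : E} {M : ℝ}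
    (hM : ∀ x ∈ U, ⟪hessian φ x e, e⟫ ≤ M) {x₀ : E} (hx₀ : x₀ ∈ U)
    (hx₀M : ⟪hessian φ x₀ e, e⟫ = M) {x : E} (hx : x ∈ U) : ⟪hessian φ x e, e⟫ = M := by
  set w : E → ℝ := fun x => ⟪hessian φ x e, e⟫ with hw
  have hwcont : ContinuousOn w U := fun x hx => ContinuousAt.continuousWithinAt
    (((continuousAt_hessian (hφ x hx)).clm_apply continuousAt_const).inner continuousAt_const)
  have hopen : IsOpen {x | x ∈ U ∧ w x = M} := by
    rw [isOpen_iff_mem_nhds]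
    rintro z ⟨hzU, hzM⟩
    obtain ⟨d, hd, hdU⟩ := Metric.nhds_basis_closedBall.mem_iff.1 (hU.mem_nhds hzU)
    -- With p within d/2 of z, the touching ball lies within d of z, so cutting the maximum set off
    -- at radius d hides none of its points.
    refine Metric.mem_nhds_iff.2 ⟨d / 2, by positivity, fun p hp => ?_⟩
    rw [Metric.mem_ball] at hp
    have hpU : p ∈ U := hdU (Metric.mem_closedBall.2 (by linarith))
    refine ⟨hpU, ?_⟩
    by_contra hpM
    have hC : IsCompact {x | x ∈ Metric.closedBall z d ∧ w x = M} := by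
      refine (isCompact_closedBall z d).of_isClosed_subset ?_ fun x hx => hx.1
      exact (hwcont.mono hdU).preimage_isClosed_of_isClosed Metric.isClosed_closedBall
        isClosed_singleton
    obtain ⟨q, hq, y, r, hr, hqy, hqp, hball⟩ :=
      exists_touching_ball hC ⟨z, Metric.mem_closedBall_self hd.le, hzM⟩
        (p := p) (fun h => hpM h.2)
    have hsmall := hqp z ⟨Metric.mem_closedBall_self hd.le, hzM⟩
    rw [dist_comm] at hsmall
    refine not_touching_second_derivative hU hφ hpos hdet hM hr (hdU hq.1) hqy
      (fun x hxU hxr hxq => (hM x hxU).lt_of_ne fun hxM => ?_) hq.2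
    obtain ⟨h1, h2⟩ := hball x hxr hxq
    refine h2 ⟨?_, hxM⟩
    have h3 := dist_triangle x p z
    rw [Metric.mem_closedBall]
    linarith
  have hopen' : IsOpen {x | x ∈ U ∧ w x ≠ M} :=
    hwcont.isOpen_inter_preimage hU isOpen_compl_singleton
  have hsub := hUc.subset_left_of_subset_union hopen hopen'
    (Set.disjoint_left.2 fun x h1 h2 => h2.2 h1.2)
    (fun x hx => (em (w x = M)).imp (fun h => ⟨hx, h⟩) fun h => ⟨hx, h⟩)
    ⟨x₀, hx₀, hx₀, hx₀M⟩
  exact (hsub hx).2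

/-- A positively homogeneous function of degree two with constant positive Hessian determinant has
constant Hessian. -/
lemma exists_hessian_eq_const (hhom : ∀ t : ℝ, 0 < t → ∀ x, φ (t • x) = t ^ 2 * φ x)
    (hdiff : ∀ x, x ≠ 0 → ContDiffAt ℝ 2 φ x)
    (hpos : ∀ x, x ≠ 0 → ∀ v, v ≠ 0 → 0 < ⟪hessian φ x v, v⟫) {c : ℝ}
    (hdet : ∀ x, x ≠ 0 → (hessian φ x).det = c) :
    ∃ A : E →L[ℝ] E, ∀ x, x ≠ 0 → hessian φ x = A := by
  rcases lt_trichotomy (Module.finrank ℝ E) 1 with h0 | h1 | h2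
  · have : Subsingleton E := Module.finrank_zero_iff (R := ℝ).1 (by omega)
    exact ⟨0, fun x hx => (hx (Subsingleton.elim x 0)).elim⟩
  -- On a line the complement of the origin is disconnected and the maximum principle cannot compare
  -- the two rays, but there the Hessian is multiplication by its determinant.
  · refine ⟨c • ContinuousLinearMap.id ℝ E, fun x hx => ?_⟩
    obtain ⟨a, ha⟩ := exists_smul_eq_of_finrank_eq_one h1 hx (hessian φ x x)
    have h3 : (hessian φ x : E →ₗ[ℝ] E) = a • LinearMap.id := by
      ext v
      obtain ⟨s, rfl⟩ := exists_smul_eq_of_finrank_eq_one h1 hx v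
      simp only [map_smul, ContinuousLinearMap.coe_coe, ← ha, LinearMap.smul_apply,
        LinearMap.id_apply]
    have h4 := hdet x hx
    rw [ContinuousLinearMap.det, h3, LinearMap.det_smul, h1, LinearMap.det_id, pow_one,
      mul_one] at h4
    rw [← h4]
    ext v
    exact congrArg (fun L => L v) h3
  · have hnt : Nontrivial E := Module.nontrivial_of_finrank_pos (R := ℝ) (by omega)
    have hconn : IsPreconnected ({0}ᶜ : Set E) :=
      (isConnected_compl_singleton_of_one_lt_rank
        (by rw [← Module.finrank_eq_rank]; exact_mod_cast h2) 0).isPreconnected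
    -- The second derivative in direction e is constant on rays, so its maximum over the unit sphere
    -- is a global one, attained in the connected punctured space.
    have hsecond : ∀ e, ∃ M, ∀ x, x ≠ 0 → ⟪hessian φ x e, e⟫ = M := by
      intro e
      have hcont : ContinuousOn (fun x => ⟪hessian φ x e, e⟫) (Metric.sphere (0 : E) 1) :=
        fun x hx => ContinuousAt.continuousWithinAt
          (((continuousAt_hessian (hdiff x (by rintro rfl; simp at hx))).clm_apply
            continuousAt_const).inner continuousAt_const)
      obtain ⟨u, hu, hmax⟩ := (isCompact_sphere (0 : E) 1).exists_isMaxOn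
        (NormedSpace.sphere_nonempty.2 zero_le_one) hcont
      have hu0 : u ≠ 0 := by rintro rfl; simp at hu
      refine ⟨⟪hessian φ u e, e⟫, fun x hx => second_derivative_eq_of_isMax isOpen_compl_singleton
        hconn hdiff hpos hdet (fun x hx => ?_) hu0 rfl hx⟩
      have hxn : 0 < ‖x‖ := norm_pos_iff.2 hx
      rw [← hessian_pos_smul hhom hdiff (inv_pos.2 hxn) hx]
      refine hmax ?_
      rw [mem_sphere_zero_iff_norm, norm_smul, norm_inv, norm_norm, inv_mul_cancel₀ hxn.ne']
    choose M hM using hsecond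
    obtain ⟨x₀, hx₀⟩ := exists_ne (0 : E)
    refine ⟨hessian φ x₀, fun x hx => ?_⟩
    -- Polarization recovers the symmetric Hessian from its quadratic form.
    have hpolar : ∀ y, y ≠ 0 → ∀ v w,
        ⟪hessian φ y v, w⟫ = (M (v + w) - M v - M w) / 2 := fun y hy v w => by
      rw [← hM (v + w) y hy, ← hM v y hy, ← hM w y hy, map_add, inner_add_left, inner_add_right,
        inner_add_right, inner_hessian_comm (hdiff y hy) w v, real_inner_comm (hessian φ y v) w]
      ring
    ext1 v
    refine ext_inner_right ℝ fun w => ?_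
    rw [hpolar x hx, hpolar x₀ hx₀]

end Rigidity

/-! ### Ellipsoids and constant Hessian determinant -/

section Ellipsoid

open CentroAffine

variable {n : ℕ} {K : Set (EuclideanSpace ℝ (Fin n))}

local notation "𝔼" => EuclideanSpace ℝ (Fin n)

/-- The linear map T from an orthonormal basis to a frame orthonormal for A turns the form of A into
the Euclidean norm, so it maps the unit ball onto K. -/
lemma isCenteredEllipsoid_of_mem_iff {A : 𝔼 →ₗ[ℝ] 𝔼} (hA : A.IsSymmetric)
    (hpos : ∀ v, v ≠ 0 → 0 < ⟪A v, v⟫) (hK : ∀ x, x ∈ K ↔ ⟪A x, x⟫ ≤ 1) :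
    IsCenteredEllipsoid K := by
  obtain ⟨u, hu, -, -⟩ := exists_frame hA hpos
  set b := stdOrthonormalBasis ℝ 𝔼 with hb
  set T : 𝔼 →ₗ[ℝ] 𝔼 := b.toBasis.constr ℝ u with hT
  have hTexp : ∀ y, T y = ∑ i, ⟪b i, y⟫ • u i := fun y => by
    conv_lhs => rw [← b.sum_repr' y, map_sum]
    refine Finset.sum_congr rfl fun i _ => ?_
    rw [map_smul, ← b.coe_toBasis, hT, Module.Basis.constr_basis]
  have hnorm : ∀ y, ⟪A (T y), T y⟫ = ‖y‖ ^ 2 := fun y => by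
    rw [hTexp, map_sum, sum_inner, ← b.sum_sq_norm_inner_right y]
    refine Finset.sum_congr rfl fun i _ => ?_
    rw [inner_sum]
    simp only [map_smul, real_inner_smul_left, real_inner_smul_right, hu]
    simp [sq]
  have hinj : Function.Injective T := by
    refine (injective_iff_map_eq_zero T).2 fun y hy => ?_
    have := hnorm y
    rw [hy, map_zero, inner_zero_left] at this
    exact norm_eq_zero.1 (pow_eq_zero_iff (two_ne_zero)|>.1 this.symm)
  set e := LinearEquiv.ofInjectiveEndo T hinj with he
  refine ⟨e, ?_⟩
  have hmem : ∀ y, e y ∈ K ↔ ‖y‖ ≤ 1 := fun y => by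
    have h1 : e y = T y := rfl
    rw [hK, h1, hnorm, sq_le_one_iff₀ (norm_nonneg y)]
  ext x
  constructor
  · intro hx
    refine ⟨e.symm x, ?_, e.apply_symm_apply x⟩
    rw [mem_closedBall_zero_iff, ← hmem, e.apply_symm_apply]
    exact hx
  · rintro ⟨y, hy, rfl⟩
    exact (hmem y).2 (mem_closedBall_zero_iff.1 hy)

lemma IsC2PlusBody.isCenteredEllipsoid_of_det_hessian_eq (hK : IsC2PlusBody K) {c : ℝ}
    (hc : ∀ x, x ≠ 0 → (hessian (gaugeEnergy K) x).det = c) : IsCenteredEllipsoid K := by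
  have hsymm : ∀ x : 𝔼, x ≠ 0 → (hessian (gaugeEnergy K) x : 𝔼 →ₗ[ℝ] 𝔼).IsSymmetric :=
    fun x hx v w => inner_hessian_comm (hK.contDiffAt_gaugeEnergy x hx) v w
  have hpos : ∀ x : 𝔼, x ≠ 0 → ∀ v, v ≠ 0 → 0 < ⟪hessian (gaugeEnergy K) x v, v⟫ :=
    fun x hx v hv => inner_apply_self_pos (hsymm x hx)
      (inner_hessian_nonneg hK.convexOn_gaugeEnergy (hK.contDiffAt_gaugeEnergy x hx))
      (hK.det_pos x hx).ne' hv
  obtain ⟨A, hA⟩ := exists_hessian_eq_const IsBodyAroundZero.gaugeEnergy_pos_smul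
    hK.contDiffAt_gaugeEnergy hpos hc
  rcases subsingleton_or_nontrivial 𝔼 with hsub | hnt
  · refine ⟨LinearEquiv.refl ℝ 𝔼, ?_⟩
    ext x
    have h0 := interior_subset hK.zero_mem_interior
    rw [Subsingleton.elim x 0]
    simp [h0]
  obtain ⟨x₀, hx₀⟩ := exists_ne (0 : 𝔼)
  refine isCenteredEllipsoid_of_mem_iff (A := (A : 𝔼 →ₗ[ℝ] 𝔼)) ?_ ?_ fun x => ?_
  · rw [← hA x₀ hx₀]; exact hsymm x₀ hx₀
  · rw [← hA x₀ hx₀]; exact hpos x₀ hx₀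
  · rcases eq_or_ne x 0 with rfl | hx
    · simp [interior_subset hK.zero_mem_interior]
    -- Applying Euler's relation twice, ⟪A x, x⟫ = ⟪∇φ(x), x⟫ = 2φ(x), which is the squared gauge.
    have h1 := inner_gradient_self IsBodyAroundZero.gaugeEnergy_pos_smul
      hK.contDiffAt_gaugeEnergy hx
    rw [← hessian_self IsBodyAroundZero.gaugeEnergy_pos_smul hK.contDiffAt_gaugeEnergy hx, hA x hx,
      gaugeEnergy, mul_div_cancel₀ _ (two_ne_zero' ℝ)] at h1
    rw [ContinuousLinearMap.coe_coe, h1, sq_le_one_iff₀ (gauge_nonneg x), hK.gauge_le_one_iff]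

/-- The gauge is the norm of the inverse linear map, so the energy is a quadratic form and its
gradient is linear. -/
lemma exists_det_hessian_eq_of_isCenteredEllipsoid (hK : IsBodyAroundZero K)
    (hE : IsCenteredEllipsoid K) : ∃ c, ∀ x, (hessian (gaugeEnergy K) x).det = c := by
  obtain ⟨A, hA⟩ := hE
  have hmem : ∀ x, x ∈ K ↔ ‖A.symm x‖ ≤ 1 := fun x => by
    rw [hA]
    constructor
    · rintro ⟨y, hy, rfl⟩
      simpa using hy
    · intro hx
      exact ⟨A.symm x, by simpa using hx, A.apply_symm_apply x⟩
  have hgauge : ∀ x, gauge K x = ‖A.symm x‖ := fun x => by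
    rcases eq_or_ne x 0 with rfl | hx
    · simp [gauge_zero]
    have hg := hK.gauge_pos hx
    have hN : 0 < ‖A.symm x‖ := norm_pos_iff.2 ((map_ne_zero_iff _ A.symm.injective).2 hx)
    refine le_antisymm ?_ ?_
    · have h1 := hK.gauge_le_one_iff.2 ((hmem (‖A.symm x‖⁻¹ • x)).2 (by
        rw [map_smul, norm_smul, norm_inv, norm_norm, inv_mul_cancel₀ hN.ne']))
      rwa [IsBodyAroundZero.gauge_pos_smul (by positivity), inv_mul_le_iff₀ hN, mul_one] at h1
    · have h1 := (hmem _).1 (hK.isCompact.isClosed.frontier_subset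
        (hK.inv_gauge_smul_mem_frontier hx))
      rwa [map_smul, norm_smul, norm_inv, Real.norm_of_nonneg hg.le, inv_mul_le_iff₀ hg,
        mul_one] at h1
  set B : 𝔼 →L[ℝ] 𝔼 := LinearMap.toContinuousLinearMap (A.symm : 𝔼 →ₗ[ℝ] 𝔼) with hB
  have hgrad : ∇ (gaugeEnergy K) = (ContinuousLinearMap.adjoint B ∘L B) := by
    refine gradient_eq fun x => ?_
    rw [hasGradientAt_iff_hasFDerivAt]
    have h1 : HasFDerivAt (fun x => ‖B x‖ ^ 2 * 2⁻¹) _ x := (B.hasFDerivAt.norm_sq).mul_const 2⁻¹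
    have h2 : gaugeEnergy K = fun x => ‖B x‖ ^ 2 * 2⁻¹ := by
      ext y
      rw [gaugeEnergy, hgauge, div_eq_mul_inv]
      rfl
    rw [h2]
    refine h1.congr_fderiv ?_
    ext v
    simp [ContinuousLinearMap.adjoint_inner_left]
  refine ⟨(ContinuousLinearMap.adjoint B ∘L B).det, fun x => ?_⟩
  rw [hessian, hgrad, ContinuousLinearMap.fderiv]

end Ellipsoid

/-! ### Reduction of the theorem to Chebyshev's inequality -/

namespace CentroAffine

variable {n : ℕ} {K : Set (EuclideanSpace ℝ (Fin n))}

lemma isC2PlusBody_of_gaussCurvature_pos (hK : IsC2Body K)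
    (hpos : ∀ x ∈ frontier K, 0 < gaussCurvature K x) : IsC2PlusBody K := by
  refine ⟨hK, fun x hx => ?_⟩
  have hg := hK.gauge_pos hx
  have hmem := hK.inv_gauge_smul_mem_frontier hx
  rw [← hK.det_hessian_pos_smul (inv_pos.2 hg) hx, ← hK.centroAffineCurvature_eq hmem]
  set z := (gauge K x)⁻¹ • x
  have hz := hK.ne_zero_of_mem_frontier hmem
  refine div_pos (hpos z hmem) (pow_pos ?_ _)
  rw [hK.gaussMap_eq hmem, real_inner_smul_right, real_inner_comm,
    inner_gradient_self IsBodyAroundZero.gaugeEnergy_pos_smul hK.contDiffAt_gaugeEnergy hz]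
  have h1 := hK.gaugeEnergy_pos hz
  have h2 := norm_pos_iff.2 (hK.gradient_gaugeEnergy_ne_zero hz)
  positivity

/-- The dual index q is designed so that q/(n+q) = -p/(n+p). In the infinite case the exponent is 1,
and the integral of the Jacobian is the volume of the polar body. -/
lemma lpAffineSurfaceArea_dualIndex [NeZero n] (hK : IsC2PlusBody K) {p : ℝ}
    (hpn : p ≠ -(n : ℝ)) :
    lpAffineSurfaceArea (dualIndex n p) K =
      n * ∫ x in K, (hessian (gaugeEnergy K) x).det ^ (-(p / (n + p))) := by
  have hn : (n : ℝ) ≠ 0 := NeZero.ne _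
  have hnp : (n : ℝ) + p ≠ 0 := fun h => hpn (by linarith)
  rw [dualIndex]
  split_ifs with h
  · have hs : -(p / (n + p)) = 1 - 0 := by field_simp; linarith
    rw [hs, ← integral_det_hessian_polarBody hK, ← vol_eq_integral_rpow_zero]
    rfl
  · rw [lpAffineSurfaceArea_coe hK.toIsC2Body]
    have hs : -((n : ℝ) * p) / (n + 2 * p) / (n + -(n * p) / (n + 2 * p)) = -(p / (n + p)) := by
      have h1 : (n : ℝ) + -(n * p) / (n + 2 * p) = n * (n + p) / (n + 2 * p) := by
        rw [eq_div_iff h, add_mul, div_mul_cancel₀ _ h]; ring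
      rw [h1, div_div_div_cancel_right₀ h, neg_div, mul_div_mul_left _ _ hn]
    rw [hs]

end CentroAffine

open CentroAffine in
/-- The Chebyshev inequality for the centro-affine curvature of a body. -/
lemma IsC2PlusBody.sign_mul_integral_det_hessian_div_le {n : ℕ} [NeZero n]
    {K : Set (EuclideanSpace ℝ (Fin n))} (hK : IsC2PlusBody K) {s : ℝ} (hs : s ≠ 0) :
    let I : ℝ → ℝ := fun s => ∫ x in K, (hessian (gaugeEnergy K) x).det ^ s
    Real.sign s * (I s / I (1 + s)) ≤ Real.sign s * (I 0 / I 1) ∧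
      (Real.sign s * (I s / I (1 + s)) = Real.sign s * (I 0 / I 1) ↔ IsCenteredEllipsoid K) := by
  obtain ⟨a, b, ha, hab⟩ := exists_bounds_det_hessian hK
  have h0 : ∀ᵐ y : EuclideanSpace ℝ (Fin n) ∂(volume.restrict K), y ≠ 0 :=
    ae_restrict_of_ae (by simp [ae_iff])
  have hfin : IsFiniteMeasure (volume.restrict K) :=
    isFiniteMeasure_restrict.2 hK.isCompact.measure_lt_top.ne
  have hne : NeZero (volume.restrict K) := ⟨fun h => by
    have h1 := Measure.measure_pos_of_mem_nhds volume hK.mem_nhds_zero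
    exact h1.ne' (Measure.restrict_eq_zero.1 h)⟩
  have h := sign_mul_integral_rpow_div_le (measurable_det_hessian (gaugeEnergy K)) ha
    (h0.mono fun x hx => hab x hx) hs
  refine ⟨h.1, h.2.trans ⟨fun ⟨c, hc⟩ => ?_, fun hE => ?_⟩⟩
  · exact hK.isCenteredEllipsoid_of_det_hessian_eq
      fun x hx => det_hessian_eq_const_of_ae hK.toIsC2Body hc hx
  · obtain ⟨c, hc⟩ := exists_det_hessian_eq_of_isCenteredEllipsoid hK.toIsBodyAroundZero hE
    exact ⟨c, .of_forall hc⟩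

theorem theorem3p1 (n : ℕ) (hn : 1 ≤ n) (K : ConvexBody (EuclideanSpace ℝ (Fin n)))
    (h0 : (0 : EuclideanSpace ℝ (Fin n)) ∈ interior (K : Set (EuclideanSpace ℝ (Fin n))))
    (hC2 : CentroAffine.HasC2Boundary (K : Set (EuclideanSpace ℝ (Fin n))))
    (hpos : ∀ x ∈ frontier (K : Set (EuclideanSpace ℝ (Fin n))),
      0 < CentroAffine.gaussCurvature (K : Set (EuclideanSpace ℝ (Fin n))) x)
    (p : ℝ) (hp0 : p ≠ 0) (hpn : p ≠ -(n : ℝ)) :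
    let B : Set (EuclideanSpace ℝ (Fin n)) := K
    let B' : Set (EuclideanSpace ℝ (Fin n)) := CentroAffine.polarBody B
    let q : OnePoint ℝ := CentroAffine.dualIndex n p
    let sgn : ℝ := Real.sign (p / (n + p))
    let lower : ℝ :=
      CentroAffine.lpAffineSurfaceArea (p : OnePoint ℝ) B / CentroAffine.lpAffineSurfaceArea q B'
    let ratio : ℝ := CentroAffine.vol B / CentroAffine.vol B'
    let upper : ℝ :=
      CentroAffine.lpAffineSurfaceArea q B / CentroAffine.lpAffineSurfaceArea (p : OnePoint ℝ) B'
    (sgn * lower ≤ sgn * ratio ∧ sgn * ratio ≤ sgn * upper) ∧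
      (sgn * lower = sgn * ratio ↔ CentroAffine.IsCenteredEllipsoid B) ∧
      (sgn * ratio = sgn * upper ↔ CentroAffine.IsCenteredEllipsoid B) := by
  intro B B' q sgn lower ratio upper
  have : NeZero n := ⟨by omega⟩
  have hn0 : (n : ℝ) ≠ 0 := NeZero.ne _
  have hnp : (n : ℝ) + p ≠ 0 := fun h => hpn (by linarith)
  have hB : IsC2PlusBody B := CentroAffine.isC2PlusBody_of_gaussCurvature_pos
    (CentroAffine.isC2Body_of_hasC2Boundary ⟨K.isCompact, K.convex, h0⟩ hC2) hpos
  have hB' : IsC2PlusBody B' := hB.isC2PlusBody_polarBody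
  set s : ℝ := p / (n + p) with hs
  have hs0 : s ≠ 0 := div_ne_zero hp0 hnp
  set I : ℝ → ℝ := fun s => ∫ x in B, (hessian (gaugeEnergy B) x).det ^ s with hI
  have hvol : CentroAffine.vol B = I 0 := vol_eq_integral_rpow_zero _ _
  have hvol' : CentroAffine.vol B' = I 1 := by
    rw [vol_eq_integral_rpow_zero B' (gaugeEnergy B'), integral_det_hessian_polarBody hB, sub_zero]
  have hp : CentroAffine.lpAffineSurfaceArea (p : OnePoint ℝ) B = n * I s :=
    lpAffineSurfaceArea_coe hB.toIsC2Body p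
  have hp' : CentroAffine.lpAffineSurfaceArea (p : OnePoint ℝ) B' = n * I (1 - s) := by
    rw [lpAffineSurfaceArea_coe hB'.toIsC2Body, integral_det_hessian_polarBody hB]
  have hq : CentroAffine.lpAffineSurfaceArea q B = n * I (-s) :=
    CentroAffine.lpAffineSurfaceArea_dualIndex hB hpn
  have hq' : CentroAffine.lpAffineSurfaceArea q B' = n * I (1 + s) := by
    rw [CentroAffine.lpAffineSurfaceArea_dualIndex hB' hpn, integral_det_hessian_polarBody hB,
      sub_neg_eq_add]
  have hlower : lower = I s / I (1 + s) := by
    simp only [lower, hp, hq', mul_div_mul_left _ _ hn0]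
  have hupper : upper = I (-s) / I (1 - s) := by
    simp only [upper, hq, hp', mul_div_mul_left _ _ hn0]
  have hratio : ratio = I 0 / I 1 := by simp only [ratio, hvol, hvol']
  have h1 := hB.sign_mul_integral_det_hessian_div_le hs0
  -- The right inequality is the left one with -s in place of s; the change of sign reverses its
  -- direction.
  have h2 := hB.sign_mul_integral_det_hessian_div_le (neg_ne_zero.2 hs0)
  simp only at h1 h2
  rw [Real.sign_neg, ← sub_eq_add_neg] at h2
  rw [hlower, hupper, hratio]
  refine ⟨⟨h1.1, ?_⟩, h1.2, ?_⟩
  · have := h2.1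
    change -Real.sign s * (I (-s) / I (1 - s)) ≤ -Real.sign s * (I 0 / I 1) at this
    change Real.sign s * _ ≤ Real.sign s * _
    linarith
  · rw [← h2.2]
    change Real.sign s * (I 0 / I 1) = Real.sign s * (I (-s) / I (1 - s)) ↔
      -Real.sign s * (I (-s) / I (1 - s)) = -Real.sign s * (I 0 / I 1)
    rw [neg_mul, neg_mul, neg_inj, eq_comm]
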